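/- Let $R=\mathbb{C}[x_0,\dots,x_n]$, $V=R_1$, $\mathbb{P}^n=\mathbb{P}(V)$ (Grothendieck notation), and let $I\subset R$ be an ideal generated by quadrics with linear strand $I\leftarrow F_0\otimes R(-2)\leftarrow F_1\otimes R(-3)\leftarrow\cdots$ (the linear part of the minimal graded free resolution of $I$). Let $p\ge 1$, $k\ge 0$ and let $f\in F_p$ be a $p$-th linear syzygy of rank $p+k+1$; that is, the smallest subspace $G\subset F_{p-1}$ such that $f$ is mapped into $V\otimes G$ (the space of $(p-1)$-st syzygies involved in $f$) has dimension $p+k+1$. Let $\theta\in V\otimes G$ be the image of $f$. Then the following hold. 1. The inclusions of $f$ in $F_p$ and of $G$ in $F_{p-1}$ extend to a degree-preserving map from the Koszul complex $$\textstyle\bigwedge^{p+1}G\otimes R(-1)\leftarrow\bigwedge^{p}G\otimes R(-2)\leftarrow\cdots\leftarrow G\otimes R(-p-1)\leftarrow f\otimes R(-p-2)$$ (with differential given by multiplication by $\theta$) to the complex $R\leftarrow F_0\otimes R(-2)\leftarrow\cdots\leftarrow F_p\otimes R(-p-2)$. The ideal $I_f$ generated by the image of $\bigwedge^pG$ in $I$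 (the syzygy ideal of $f$) is the same for every such extension. Put $\operatorname{Syz}(f)=V(I_f)\subset\mathbb{P}(V)$. 2. Fix any such extension, let $\alpha:\bigwedge^{p+1}G\to V$ be its last vertical map, and fix any isomorphism $\bigwedge^kG^*\cong\bigwedge^{p+1}G$ given by contraction with a nonzero element of the top exterior power of $G$. Let $\varphi:G^*\oplus\bigwedge^kG^*\to V$ be the linear map which on $G^*$ is contraction with $\theta$ and on $\bigwedge^kG^*$ is $\alpha$. Let the $k$-th generic syzygy ideal of $G$ be the ideal of $S=\operatorname{Sym}(G^*\oplus\bigwedge^kG^*)$ generated by the quadrics $\bigwedge^{k+1}G^*\subset G^*\otimes\bigwedge^kG^*\subset S_2$, and let $\operatorname{Gensyz}_k(G)\subset\mathbb{P}(G^*\oplus\bigwedge^kG^*)$ be the scheme which it defines. Then the ring homomorphism $S\to R$ induced by $\varphi$ maps the space of quadrics $\bigwedge^{k+1}G^*$ onto the space of quadrics that is the image of $\bigwedge^pG$ in $I$; in particular $I_f$ is the ideal of $R$ generated by the image of the generic syzygy ideal. 3. In the situation of 2, $\operatorname{Syz}(f)$ is the cone, with vertex $V(\operatorname{Im}\varphi)\subset\mathbb{P}(V)$,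 over the linear section $\mathbb{P}(\operatorname{Im}\varphi)\cap\operatorname{Gensyz}_k(G)$. Here the linear section is given by the image in $\operatorname{Sym}(\operatorname{Im}\varphi)$ of the generic syzygy ideal, and the cone over the scheme given by a homogeneous ideal $J\subset\operatorname{Sym}(\operatorname{Im}\varphi)$ is the subscheme of $\mathbb{P}(V)$ given by the ideal $J\cdot R$. The equality holds for the homogeneous ideals, hence for the closed subschemes of $\mathbb{P}(V)$. -/

import Mathlib

noncomputable section

open scoped TensorProduct

namespace GenSyz

/-! ### Graded algebras, closed subschemes of `Proj` -/

section Graded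

variable {A B : Type} [CommRing A] [Algebra ℂ A] [CommRing B] [Algebra ℂ B]
  (𝒜 : ℕ → Submodule ℂ A) [GradedAlgebra 𝒜] (ℬ : ℕ → Submodule ℂ B) [GradedAlgebra ℬ]

variable {𝒜} in
/-- The grading of the quotient ring `A ⧸ J` by a homogeneous ideal `J`: its degree `i` part is the
image of the degree `i` part of `A`. -/
def quotGrading (J : HomogeneousIdeal 𝒜) (i : ℕ) : Submodule ℂ (A ⧸ J.toIdeal) :=
  (𝒜 i).map (Ideal.Quotient.mkₐ ℂ J.toIdeal).toLinearMap

variable {𝒜}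

instance quotGrading.gradedMonoid (J : HomogeneousIdeal 𝒜) :
    SetLike.GradedMonoid (quotGrading J) where
  one_mem := ⟨1, SetLike.GradedOne.one_mem, map_one (Ideal.Quotient.mk J.toIdeal)⟩
  mul_mem := by
    rintro i j _ _ ⟨a, ha, rfl⟩ ⟨b, hb, rfl⟩
    exact ⟨a * b, SetLike.GradedMul.mul_mem ha hb, map_mul (Ideal.Quotient.mk J.toIdeal) _ _⟩

/-- The projection of the degree `i` part of `A` to the degree `i` part of `A ⧸ J`. -/
def quotDegree (J : HomogeneousIdeal 𝒜) (i : ℕ) : 𝒜 i →ₗ[ℂ] quotGrading J i :=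
  ((Ideal.Quotient.mkₐ ℂ J.toIdeal).toLinearMap.domRestrict (𝒜 i)).codRestrict _
    fun a => ⟨a.1, a.2, rfl⟩

/-- The decomposition of elements of `A`, read modulo `J`. -/
def quotDecomposeAux (J : HomogeneousIdeal 𝒜) : A →ₐ[ℂ] DirectSum ℕ fun i => quotGrading J i :=
  AlgHom.comp
    (DirectSum.toAlgebra ℂ (fun i => 𝒜 i)
      (fun i => (DirectSum.lof ℂ ℕ (fun i => quotGrading J i) i).comp (quotDegree J i))
      (by
        change DirectSum.of (fun i => quotGrading J i) 0 _ = 1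
        rfl)
      (by
        intro i j a b
        simp only [LinearMap.comp_apply, DirectSum.lof_eq_of]
        rw [DirectSum.of_mul_of]
        congr 1))
    (DirectSum.decomposeAlgEquiv 𝒜).toAlgHom

lemma quotDecomposeAux_of_mem (J : HomogeneousIdeal 𝒜) {i : ℕ} {a : A} (ha : a ∈ 𝒜 i) :
    quotDecomposeAux J a = DirectSum.of (fun i => quotGrading J i) i (quotDegree J i ⟨a, ha⟩) := by
  simp [quotDecomposeAux, DirectSum.decomposeAlgEquiv, DirectSum.decompose_of_mem 𝒜 ha,
    DirectSum.toAlgebra, DirectSum.toSemiring, DirectSum.lof_eq_of]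

open Classical in
lemma quotDecomposeAux_apply (J : HomogeneousIdeal 𝒜) (a : A) :
    quotDecomposeAux J a = ∑ i ∈ (DirectSum.decompose 𝒜 a).support,
      DirectSum.of (fun i => quotGrading J i) i (quotDegree J i (DirectSum.decompose 𝒜 a i)) := by
  conv_lhs => rw [← DirectSum.sum_support_decompose 𝒜 a, map_sum]
  exact Finset.sum_congr rfl fun i _ => quotDecomposeAux_of_mem J (SetLike.coe_mem _)

instance quotGrading.gradedAlgebra (J : HomogeneousIdeal 𝒜) : GradedAlgebra (quotGrading J) :=
  GradedAlgebra.ofAlgHom _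
    (Ideal.Quotient.liftₐ J.toIdeal (quotDecomposeAux J) (by
      intro a ha
      rw [quotDecomposeAux_apply]
      refine Finset.sum_eq_zero fun i _ => ?_
      have : quotDegree J i (DirectSum.decompose 𝒜 a i) = 0 := by
        apply Subtype.ext
        exact Ideal.Quotient.eq_zero_iff_mem.2 (J.isHomogeneous i ha)
      rw [this, map_zero]))
    (by
      apply Ideal.Quotient.algHom_ext
      ext a
      simp only [AlgHom.comp_apply]
      change DirectSum.coeAlgHom (quotGrading J) (quotDecomposeAux J a) = _
      rw [quotDecomposeAux_apply, map_sum]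
      simp only [DirectSum.coeAlgHom_of]
      change ∑ i ∈ _, Ideal.Quotient.mk J.toIdeal (DirectSum.decompose 𝒜 a i : A) = _
      classical
      rw [← map_sum, DirectSum.sum_support_decompose]
      rfl)
    (by
      rintro i ⟨_, a, ha, rfl⟩
      change quotDecomposeAux J a = _
      rw [quotDecomposeAux_of_mem J ha]
      rfl)

/-- The projection `A → A ⧸ J` as a homomorphism of graded rings. -/
def quotHom (J : HomogeneousIdeal 𝒜) : 𝒜 →+*ᵍ quotGrading J where
  toRingHom := Ideal.Quotient.mk J.toIdeal
  map_mem := fun ha => ⟨_, ha, rfl⟩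

lemma irrelevant_le_map_quotHom (J : HomogeneousIdeal 𝒜) :
    HomogeneousIdeal.irrelevant (quotGrading J) ≤
      (HomogeneousIdeal.irrelevant 𝒜).map (quotHom J) := by
  intro x hx
  obtain ⟨a, rfl⟩ := Ideal.Quotient.mk_surjective x
  have h0 : quotHom J (DirectSum.decompose 𝒜 a 0 : A) = 0 := by
    rw [(quotHom J).map_directSumDecompose]
    exact hx
  have h1 : a - (DirectSum.decompose 𝒜 a 0 : A) ∈ HomogeneousIdeal.irrelevant 𝒜 := by
    rw [HomogeneousIdeal.mem_irrelevant_iff, map_sub, GradedRing.proj_apply, GradedRing.proj_apply]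
    simp
  have h2 : quotHom J a = quotHom J (a - (DirectSum.decompose 𝒜 a 0 : A)) := by
    rw [map_sub, h0, sub_zero]
  change quotHom J a ∈ _
  rw [h2]
  exact Ideal.mem_map_of_mem _ h1

/-- The closed subscheme `V(J) = Proj (A ⧸ J)` of `Proj A` cut out by a homogeneous ideal `J`,
as a scheme over `Proj A`. -/
def closedSubscheme (J : HomogeneousIdeal 𝒜) :
    CategoryTheory.Over (AlgebraicGeometry.Proj 𝒜) :=
  CategoryTheory.Over.mk
    (AlgebraicGeometry.Proj.map (quotHom J) (irrelevant_le_map_quotHom J))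

end Graded

/-! ### The symmetric algebra as a graded ring -/

section Sym

variable (M : Type) [AddCommGroup M] [Module ℂ M]

/-- The degree `i` part `S^i M` of the symmetric algebra of `M`. -/
def symGrading (i : ℕ) : Submodule ℂ (SymmetricAlgebra ℂ M) :=
  LinearMap.range (SymmetricAlgebra.ι ℂ M) ^ i

instance symGrading.gradedMonoid : SetLike.GradedMonoid (symGrading M) :=
  Submodule.nat_power_gradedMonoid (LinearMap.range (SymmetricAlgebra.ι ℂ M))

lemma ι_mem_symGrading (m : M) : SymmetricAlgebra.ι ℂ M m ∈ symGrading M 1 := by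
  simp [symGrading]

/-- The inclusion of `M` in degree one. -/
def symDegreeOne : M →ₗ[ℂ] symGrading M 1 :=
  (SymmetricAlgebra.ι ℂ M).codRestrict _ (ι_mem_symGrading M)

/-- The decomposition of elements of the symmetric algebra into homogeneous parts. -/
def symDecompose : SymmetricAlgebra ℂ M →ₐ[ℂ] DirectSum ℕ fun i => symGrading M i :=
  SymmetricAlgebra.lift ((DirectSum.lof ℂ ℕ (fun i => symGrading M i) 1).comp (symDegreeOne M))

lemma symDecompose_ι (m : M) : symDecompose M (SymmetricAlgebra.ι ℂ M m) =
    DirectSum.of (fun i => symGrading M i) 1 ⟨_, ι_mem_symGrading M m⟩ := by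
  simp [symDecompose, symDegreeOne, DirectSum.lof_eq_of]
  rfl

lemma symDecompose_coe (i : ℕ) (x : symGrading M i) :
    symDecompose M x = DirectSum.of (fun i => symGrading M i) i x := by
  obtain ⟨x, hx⟩ := x
  dsimp only [Subtype.coe_mk]
  unfold symGrading at hx
  induction hx using Submodule.pow_induction_on_left' with
  | algebraMap r => simp_rw [AlgHom.commutes, DirectSum.algebraMap_apply]; rfl
  | add x y i hx hy ihx ihy =>
    simp_rw [map_add, ihx, ihy, ← map_add]; rfl
  | mem_mul m hm i x hx ih =>
    obtain ⟨m, rfl⟩ := hm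
    simp_rw [map_mul, ih, symDecompose_ι, DirectSum.of_mul_of]
    exact DirectSum.of_eq_of_gradedMonoid_eq (Sigma.subtype_ext (add_comm _ _) rfl)

instance symGrading.gradedAlgebra : GradedAlgebra (symGrading M) :=
  GradedAlgebra.ofAlgHom _ (symDecompose M)
    (by
      apply SymmetricAlgebra.algHom_ext
      ext m
      change DirectSum.coeAlgHom (symGrading M) (symDecompose M _) = _
      rw [symDecompose_ι, DirectSum.coeAlgHom_of]
      rfl)
    (symDecompose_coe M)

variable {M}
variable {A : Type} [CommRing A] [Algebra ℂ A] (𝒜 : ℕ → Submodule ℂ A) [GradedAlgebra 𝒜]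

lemma symLift_mem (g : M →ₗ[ℂ] 𝒜 1) {i : ℕ} {x : SymmetricAlgebra ℂ M}
    (hx : x ∈ symGrading M i) :
    SymmetricAlgebra.lift ((𝒜 1).subtype ∘ₗ g) x ∈ 𝒜 i := by
  unfold symGrading at hx
  induction hx using Submodule.pow_induction_on_left' with
  | algebraMap r =>
    rw [AlgHom.commutes]
    exact SetLike.algebraMap_mem_graded 𝒜 r
  | add x y i hx hy ihx ihy => rw [map_add]; exact add_mem ihx ihy
  | mem_mul m hm i x hx ih =>
    obtain ⟨m, rfl⟩ := hm
    rw [map_mul, SymmetricAlgebra.lift_ι_apply, Nat.succ_eq_add_one, add_comm]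
    exact SetLike.GradedMul.mul_mem (g m).2 ih

/-- The homomorphism of graded rings `Sym M → A` induced by a linear map from `M` to the degree one
part of `A`. -/
def symLift (g : M →ₗ[ℂ] 𝒜 1) : symGrading M →+*ᵍ 𝒜 where
  toRingHom := (SymmetricAlgebra.lift ((𝒜 1).subtype ∘ₗ g)).toRingHom
  map_mem := fun hx => symLift_mem 𝒜 g hx

end Sym

/-! ### Minimal free resolutions and linear syzygies -/

/-- The homogeneous coordinate ring `ℂ[x_0, …, x_n]` of projective `n`-space. -/
abbrev CoordRing (n : ℕ) : Type := MvPolynomial (Fin (n + 1)) ℂ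

/-- Its grading by degree. -/
abbrev coordGrading (n : ℕ) : ℕ → Submodule ℂ (CoordRing n) :=
  MvPolynomial.homogeneousSubmodule (Fin (n + 1)) ℂ

instance coordGrading.gradedAlgebra (n : ℕ) : GradedAlgebra (coordGrading n) :=
  MvPolynomial.gradedAlgebra

/-- The space `V` of linear forms on projective `n`-space. -/
abbrev LinForms (n : ℕ) : Type := coordGrading n 1

/-- A minimal graded free resolution
`I ← ⨁_b R(-deg 0 b) ← ⨁_b R(-deg 1 b) ← ⋯`
of an ideal `I` of `R = ℂ[x_0, …, x_n]`, by finitely generated free modules. -/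
structure MinimalFreeResolution {n : ℕ} (I : Ideal (CoordRing n)) where
  /-- the rank of the `i`-th free module -/
  rk : ℕ → ℕ
  /-- the degrees of its generators -/
  deg : ∀ i, Fin (rk i) → ℕ
  /-- the augmentation onto `I` -/
  aug : (Fin (rk 0) → CoordRing n) →ₗ[CoordRing n] CoordRing n
  /-- the differentials -/
  diff : ∀ i, (Fin (rk (i + 1)) → CoordRing n) →ₗ[CoordRing n] (Fin (rk i) → CoordRing n)
  /-- the augmentation preserves degrees -/
  aug_homogeneous : ∀ b, (aug (Pi.single b 1)).IsHomogeneous (deg 0 b)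
  /-- the differentials preserve degrees: the `(a, b)` entry is homogeneous of degree
  `deg (i + 1) b - deg i a`, -/
  diff_homogeneous : ∀ i b a m, deg i a + m = deg (i + 1) b →
    (diff i (Pi.single b 1) a).IsHomogeneous m
  /-- and it vanishes if this difference is negative -/
  diff_eq_zero : ∀ i b a, deg (i + 1) b < deg i a → diff i (Pi.single b 1) a = 0
  /-- minimality: all entries lie in the ideal `(x_0, …, x_n)` -/
  minimal : ∀ i b a, MvPolynomial.constantCoeff (diff i (Pi.single b 1) a) = 0
  range_aug : LinearMap.range aug = I
  exact_aug : Function.Exact (diff 0) aug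
  exact_diff : ∀ i, Function.Exact (diff (i + 1)) (diff i)

namespace MinimalFreeResolution

variable {n : ℕ} {I : Ideal (CoordRing n)} (F : MinimalFreeResolution I)

/-- The generators of degree `i + 2` of the `i`-th free module. -/
abbrev LinIndex (i : ℕ) : Type := {a : Fin (F.rk i) // F.deg i a = i + 2}

/-- The space `F_i` of `i`-th linear syzygies: `F_i ⊗ R(-i-2)` is the `i`-th term of the linear
part of the resolution. -/
abbrev LinSyz (i : ℕ) : Type := F.LinIndex i → ℂ

/-- The entries of the linear part of the differential; they are linear forms. -/
def linEntry (i : ℕ) (b : F.LinIndex (i + 1)) (a : F.LinIndex i) : LinForms n :=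
  ⟨F.diff i (Pi.single b.1 1) a.1, by
    rw [MvPolynomial.mem_homogeneousSubmodule]
    exact F.diff_homogeneous i b.1 a.1 1 (by rw [a.2, b.2])⟩

/-- The linear part `F_{i+1} ⊗ R(-i-3) → F_i ⊗ R(-i-2)` of the differential, given by its values
on generators: a linear map `F_{i+1} → V ⊗ F_i`. -/
def linDiff (i : ℕ) : F.LinSyz (i + 1) →ₗ[ℂ] LinForms n ⊗[ℂ] F.LinSyz i :=
  ∑ b, (LinearMap.proj b).smulRight (∑ a, F.linEntry i b a ⊗ₜ[ℂ] Pi.single a (1 : ℂ))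

/-- The linear part `F_0 ⊗ R(-2) → R` of the augmentation, on generators. -/
def linAug : F.LinSyz 0 →ₗ[ℂ] CoordRing n :=
  ∑ b : F.LinIndex 0, (LinearMap.proj b).smulRight (F.aug (Pi.single b.1 1))

lemma linAug_mem (x : F.LinSyz 0) : F.linAug x ∈ coordGrading n 2 := by
  rw [linAug, LinearMap.sum_apply]
  refine Submodule.sum_mem _ fun b _ => Submodule.smul_mem _ _ ?_
  have := F.aug_homogeneous b.1
  rw [b.2] at this
  exact this

variable {F}

/-- The space `G ⊆ F_q` of `q`-th linear syzygies involved in a `(q+1)`-st linear syzygy `f`: the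
smallest subspace `G` such that `f` maps into `V ⊗ G`. -/
def involved {q : ℕ} (f : F.LinSyz (q + 1)) : Submodule ℂ (F.LinSyz q) :=
  sInf {G | F.linDiff q f ∈ LinearMap.range (LinearMap.lTensor (LinForms n) G.subtype)}

/-- The rank of a linear syzygy. -/
def syzRank {q : ℕ} (f : F.LinSyz (q + 1)) : ℕ := Module.finrank ℂ (involved f)

end MinimalFreeResolution

/-! ### Exterior powers: wedge product, Koszul differential, contraction -/

section Exterior

variable {G : Type} [AddCommGroup G] [Module ℂ G]

/-- The product `G × ⋀^j G → ⋀^(j+1) G`, `(g, w) ↦ g ∧ w`. -/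
def wedge (j : ℕ) : G →ₗ[ℂ] ⋀[ℂ]^j G →ₗ[ℂ] ⋀[ℂ]^(j + 1) G :=
  LinearMap.mk₂ ℂ
    (fun g w => ⟨ExteriorAlgebra.ι ℂ g * w.1, by
      rw [ExteriorAlgebra.exteriorPower, pow_succ']
      exact Submodule.mul_mem_mul (LinearMap.mem_range_self _ g) w.2⟩)
    (fun g g' w => Subtype.ext (by simp [add_mul]))
    (fun c g w => Subtype.ext (by simp))
    (fun g w w' => Subtype.ext (by simp [mul_add]))
    (fun c g w => Subtype.ext (by simp))

/-- The differential `⋀^j G → V ⊗ ⋀^(j+1) G` of the Koszul complex of `θ ∈ V ⊗ G` (multiplication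
by `θ`): for `θ = ∑ l_a ⊗ e_a` it is `w ↦ ∑ l_a ⊗ (e_a ∧ w)`. -/
def koszul {V : Type} [AddCommGroup V] [Module ℂ V] (θ : V ⊗[ℂ] G) (j : ℕ) :
    ⋀[ℂ]^j G →ₗ[ℂ] V ⊗[ℂ] ⋀[ℂ]^(j + 1) G :=
  ((LinearMap.lTensorHom V).flip θ).comp (wedge j).flip

variable (G) in
/-- The action of the exterior algebra of `G*` on the exterior algebra of `G` by contraction:
`ξ_1 ∧ ⋯ ∧ ξ_k` acts as `i_{ξ_1} ∘ ⋯ ∘ i_{ξ_k}`, where `i_ξ` is the antiderivation with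
`i_ξ g = ξ g` for `g ∈ G`. -/
def contract : ExteriorAlgebra ℂ (Module.Dual ℂ G) →ₐ[ℂ] Module.End ℂ (ExteriorAlgebra ℂ G) :=
  ExteriorAlgebra.lift ℂ ⟨CliffordAlgebra.contractLeft, fun ξ => LinearMap.ext fun x =>
    CliffordAlgebra.contractLeft_contractLeft ξ x⟩

lemma contractLeft_mem (ξ : Module.Dual ℂ G) {m : ℕ} {x : ExteriorAlgebra ℂ G}
    (hx : x ∈ ⋀[ℂ]^(m + 1) G) :
    CliffordAlgebra.contractLeft (Q := (0 : QuadraticForm ℂ G)) ξ x ∈ ⋀[ℂ]^m G := by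
  induction m generalizing x with
  | zero =>
    rw [ExteriorAlgebra.exteriorPower, zero_add, pow_one] at hx
    obtain ⟨g, rfl⟩ := hx
    rw [ExteriorAlgebra.exteriorPower, pow_zero]
    erw [CliffordAlgebra.contractLeft_ι]
    exact Submodule.algebraMap_mem _
  | succ m ih =>
    rw [ExteriorAlgebra.exteriorPower, pow_succ'] at hx
    induction hx using Submodule.mul_induction_on' with
    | mem_mul_mem a ha b hb =>
      obtain ⟨g, rfl⟩ := ha
      erw [CliffordAlgebra.contractLeft_ι_mul]
      refine Submodule.sub_mem _ (Submodule.smul_mem _ _ hb) ?_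
      rw [ExteriorAlgebra.exteriorPower, pow_succ']
      exact Submodule.mul_mem_mul (LinearMap.mem_range_self _ g) (ih hb)
    | add a _ b _ iha ihb =>
      rw [map_add]
      exact Submodule.add_mem _ iha ihb

lemma contract_mem {k m : ℕ} {η : ExteriorAlgebra ℂ (Module.Dual ℂ G)}
    (hη : η ∈ ⋀[ℂ]^k (Module.Dual ℂ G)) {x : ExteriorAlgebra ℂ G} (hx : x ∈ ⋀[ℂ]^(m + k) G) :
    contract G η x ∈ ⋀[ℂ]^m G := by
  induction k generalizing η x m with
  | zero =>
    rw [ExteriorAlgebra.exteriorPower, pow_zero] at hη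
    obtain ⟨c, rfl⟩ := Submodule.mem_one.1 hη
    rw [AlgHom.commutes]
    exact Submodule.smul_mem _ c hx
  | succ k ih =>
    rw [ExteriorAlgebra.exteriorPower, pow_succ'] at hη
    induction hη using Submodule.mul_induction_on' with
    | mem_mul_mem a ha b hb =>
      obtain ⟨ξ, rfl⟩ := ha
      rw [map_mul, contract, ExteriorAlgebra.lift_ι_apply]
      refine contractLeft_mem ξ (ih (m := m + 1) hb ?_)
      rwa [add_assoc, add_comm 1 k]
    | add a _ b _ iha ihb =>
      rw [map_add]
      exact Submodule.add_mem _ iha ihb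

/-- Contraction with `ω ∈ ⋀^(m+k) G`, as a linear map `⋀^k G* → ⋀^m G`. If `m + k = dim G` and
`ω ≠ 0`, it is the natural isomorphism `⋀^k G* ≅ ⋀^m G` (up to the choice of `ω`, which is
unique up to a scalar). -/
def contractWith {m k : ℕ} (ω : ⋀[ℂ]^(m + k) G) :
    ⋀[ℂ]^k (Module.Dual ℂ G) →ₗ[ℂ] ⋀[ℂ]^m G where
  toFun η := ⟨contract G η.1 ω.1, contract_mem η.2 ω.2⟩
  map_add' η η' := Subtype.ext (by simp)
  map_smul' c η := Subtype.ext (by simp)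

end Exterior

/-! ### The extension of a linear syzygy to the Koszul complex, and the syzygy ideal -/

section SyzygyIdeal

variable {n : ℕ} {I : Ideal (CoordRing n)} {F : MinimalFreeResolution I}

/-- An extension of the inclusions `f ⊆ F_{q+1}` and `G ⊆ F_q`, with `G` the space of linear
syzygies involved in the `(q+1)`-st linear syzygy `f`, to a map from the Koszul complex of `G` to
the linear part of the resolution:
```
R               ←  F_0 ⊗ R(-2)           ←  ⋯  ←  F_q ⊗ R(-q-2)  ←  F_{q+1} ⊗ R(-q-3)
⋀^(q+2) G⊗R(-1) ←  ⋀^(q+1) G ⊗ R(-2)     ←  ⋯  ←  G ⊗ R(-q-2)    ←  f ⊗ R(-q-3)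
```
All maps preserve degrees, so they are given by linear maps on the spaces of generators. -/
structure KoszulExtension {q : ℕ} (f : F.LinSyz (q + 1)) where
  /-- the map `f ⊗ R(-q-3) → G ⊗ R(-q-2)`, given by an element of `V ⊗ G` -/
  θ : LinForms n ⊗[ℂ] MinimalFreeResolution.involved f
  θ_eq : LinearMap.lTensor (LinForms n) (MinimalFreeResolution.involved f).subtype θ =
    F.linDiff q f
  /-- the vertical maps `⋀^j G → F_i`, for `i + j = q + 1` -/
  ψ : ∀ i j : ℕ, i + j = q + 1 →
    ⋀[ℂ]^j (MinimalFreeResolution.involved f) →ₗ[ℂ] F.LinSyz i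
  /-- the last vertical map `⋀^(q+2) G → V = R_1` -/
  α : ⋀[ℂ]^(q + 1 + 1) (MinimalFreeResolution.involved f) →ₗ[ℂ] LinForms n
  /-- the first vertical map is the inclusion of `f` -/
  ψ_zero : ∀ w, ψ (q + 1) 0 rfl w = exteriorPower.zeroEquiv ℂ _ w • f
  /-- the second vertical map is the inclusion of `G` -/
  ψ_one : ∀ w, ψ q 1 rfl w = (exteriorPower.oneEquiv ℂ _ w).1
  /-- commutativity of the squares over the linear part of the resolution -/
  comm : ∀ (i j : ℕ) (h : i + 1 + j = q + 1) (h' : i + (j + 1) = q + 1) w,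
    F.linDiff i (ψ (i + 1) j h w) = LinearMap.lTensor (LinForms n) (ψ i (j + 1) h') (koszul θ j w)
  /-- commutativity of the last square -/
  comm_aug : ∀ w, F.linAug (ψ 0 (q + 1) (zero_add _) w) =
    TensorProduct.lift ((LinearMap.mul ℂ (CoordRing n)).compl₁₂
      (coordGrading n 1).subtype ((coordGrading n 1).subtype ∘ₗ α)) (koszul θ (q + 1) w)

namespace KoszulExtension

variable {q : ℕ} {f : F.LinSyz (q + 1)} (E : KoszulExtension f)

/-- The map `⋀^p G → F_0 → I` (with `p = q + 1`), whose values are quadrics. -/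
def quadric : ⋀[ℂ]^(q + 1) (MinimalFreeResolution.involved f) →ₗ[ℂ] CoordRing n :=
  F.linAug ∘ₗ E.ψ 0 (q + 1) (zero_add _)

/-- The syzygy ideal `I_f`, generated by the image of `⋀^p G` in `I`. -/
def syzygyIdeal : HomogeneousIdeal (coordGrading n) where
  toSubmodule := Ideal.span (Set.range E.quadric)
  is_homogeneous' := Ideal.homogeneous_span _ _ (by
    rintro _ ⟨w, rfl⟩
    exact ⟨2, F.linAug_mem _⟩)

/-- The map `G* → V` exhibiting `G*` as a space of linear forms: contraction with `θ ∈ V ⊗ G`. -/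
def linearForms : Module.Dual ℂ (MinimalFreeResolution.involved f) →ₗ[ℂ] LinForms n :=
  (TensorProduct.rid ℂ (LinForms n)).toLinearMap ∘ₗ (LinearMap.lTensorHom (LinForms n)).flip E.θ

/-- The map `φ : G* ⊕ ⋀^k G* → V`: on `G*` it is the inclusion of the linear forms involved in
`f`, and on `⋀^k G* ≅ ⋀^(p+1) G` it is the map `α`. The isomorphism is the one given by a generator
`ω` of the top exterior power of `G`. -/
def φ {k : ℕ} (ω : ⋀[ℂ]^(q + 1 + 1 + k) (MinimalFreeResolution.involved f)) :
    Module.Dual ℂ (MinimalFreeResolution.involved f) ×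
      ⋀[ℂ]^k (Module.Dual ℂ (MinimalFreeResolution.involved f)) →ₗ[ℂ] LinForms n :=
  LinearMap.coprod E.linearForms (E.α ∘ₗ contractWith ω)

end KoszulExtension

end SyzygyIdeal

/-! ### Generic syzygy schemes -/

section Generic

variable (G : Type) [AddCommGroup G] [Module ℂ G] (k : ℕ)

/-- The ambient space `G* ⊕ ⋀^k G*` of linear forms. -/
abbrev GenericForms : Type := Module.Dual ℂ G × ⋀[ℂ]^k (Module.Dual ℂ G)

/-- The natural inclusion `⋀^(k+1) G* → G* ⊗ ⋀^k G*`,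
`ξ_0 ∧ ⋯ ∧ ξ_k ↦ ∑_i (-1)^i ξ_i ⊗ (ξ_0 ∧ ⋯ omit ξ_i ⋯ ∧ ξ_k)`. -/
def comult : ⋀[ℂ]^(k + 1) (Module.Dual ℂ G) →ₗ[ℂ]
    Module.Dual ℂ G ⊗[ℂ] ⋀[ℂ]^k (Module.Dual ℂ G) :=
  exteriorPower.alternatingMapLinearEquiv
    (AlternatingMap.alternatizeUncurryFin
      { toFun := fun ξ => (TensorProduct.mk ℂ (Module.Dual ℂ G) (⋀[ℂ]^k (Module.Dual ℂ G))
          ξ).compAlternatingMap (exteriorPower.ιMulti ℂ k)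
        map_add' := fun ξ ξ' => by ext; simp
        map_smul' := fun c ξ => by ext; simp [TensorProduct.smul_tmul'] })

lemma comult_ιMulti (ξ : Fin (k + 1) → Module.Dual ℂ G) :
    comult G k (exteriorPower.ιMulti ℂ (k + 1) ξ) =
      ∑ i : Fin (k + 1), (-1 : ℤ) ^ (i : ℕ) •
        (ξ i ⊗ₜ[ℂ] exteriorPower.ιMulti ℂ k fun j => ξ (i.succAbove j)) := by
  rw [comult, exteriorPower.alternatingMapLinearEquiv_apply_ιMulti,
    AlternatingMap.alternatizeUncurryFin_apply]
  rfl

/-- The composite `⋀^(k+1) G* → G* ⊗ ⋀^k G* → S²(G* ⊕ ⋀^k G*)`. -/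
def genericQuadric : ⋀[ℂ]^(k + 1) (Module.Dual ℂ G) →ₗ[ℂ] SymmetricAlgebra ℂ (GenericForms G k) :=
  TensorProduct.lift ((LinearMap.mul ℂ (SymmetricAlgebra ℂ (GenericForms G k))).compl₁₂
    (SymmetricAlgebra.ι ℂ (GenericForms G k) ∘ₗ LinearMap.inl ℂ _ _)
    (SymmetricAlgebra.ι ℂ (GenericForms G k) ∘ₗ LinearMap.inr ℂ _ _)) ∘ₗ comult G k

lemma genericQuadric_mem (η : ⋀[ℂ]^(k + 1) (Module.Dual ℂ G)) :
    genericQuadric G k η ∈ symGrading (GenericForms G k) 2 := by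
  rw [genericQuadric, LinearMap.comp_apply]
  generalize comult G k η = t
  induction t with
  | zero => rw [map_zero]; exact zero_mem _
  | add x y hx hy => rw [map_add]; exact add_mem hx hy
  | tmul x y =>
    rw [TensorProduct.lift.tmul]
    exact SetLike.GradedMul.mul_mem (ι_mem_symGrading _ (LinearMap.inl ℂ _ _ x))
      (ι_mem_symGrading _ (LinearMap.inr ℂ _ _ y))

/-- The `k`-th generic syzygy ideal of `G` in `Sym (G* ⊕ ⋀^k G*)`. The closed subscheme that it
cuts out in `ℙ(G* ⊕ ⋀^k G*)` is the generic syzygy scheme `Gensyz_k(G)`. -/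
def genericSyzygyIdeal : HomogeneousIdeal (symGrading (GenericForms G k)) where
  toSubmodule := Ideal.span (Set.range (genericQuadric G k))
  is_homogeneous' := Ideal.homogeneous_span _ _ (by
    rintro _ ⟨w, rfl⟩
    exact ⟨2, genericQuadric_mem G k w⟩)

end Generic

/-! ### Linear sections and cones -/

/-- The homogeneous ideal in `Sym W` of the linear section `ℙ(W) ∩ V(J)`, for a linear subspace
`ℙ(W) ⊆ ℙ(U)` given by a surjective linear map `π : U → W` (so points of `ℙ(U)` are one
dimensional quotients of `U`) and a homogeneous ideal `J` of `Sym U`: the equations of `V(J)` are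
restricted to `ℙ(W)`. -/
def linearSection {U W : Type} [AddCommGroup U] [Module ℂ U] [AddCommGroup W] [Module ℂ W]
    (π : U →ₗ[ℂ] W) (J : HomogeneousIdeal (symGrading U)) : HomogeneousIdeal (symGrading W) :=
  J.map (symLift (symGrading W) (symDegreeOne W ∘ₗ π))

/-- For a space `W ⊆ V` of linear forms on `ℙ(V) = ℙ^n` and a homogeneous ideal `J` of `Sym W`, the
homogeneous ideal of the cone in `ℙ(V)` over `V(J) ⊆ ℙ(W)` with vertex the linear space `V(W)`: it
is generated by the equations of `V(J)`, considered as equations on `ℙ(V)`. -/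
def cone {n : ℕ} (W : Submodule ℂ (LinForms n)) (J : HomogeneousIdeal (symGrading W)) :
    HomogeneousIdeal (coordGrading n) :=
  J.map (symLift (coordGrading n) W.subtype)

/-- The syzygy scheme `Syz(f) = V(I_f)`, a closed subscheme of projective `n`-space. -/
def KoszulExtension.Syz {n : ℕ} {I : Ideal (CoordRing n)} {F : MinimalFreeResolution I}
    {q : ℕ} {f : F.LinSyz (q + 1)} (E : KoszulExtension f) :
    CategoryTheory.Over (AlgebraicGeometry.Proj (coordGrading n)) :=
  closedSubscheme E.syzygyIdeal

end GenSyz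

end

/-! Choose a basis `e_a` of `G` and write `θ = ∑ L_a ⊗ e_a`, with `p = q + 1`. Minimality of `G`
makes the linear forms `L_a` independent: a `ξ ∈ G*` killing `θ` would put `θ` in `V ⊗ ker ξ`. Hence
the dual of the Koszul complex of `θ` is exact in positive exterior degree. This is
`exists_koszul_lift`, proved with an Euler-operator homotopy.

Existence is then the usual lifting argument: the linear strand is a complex, so each vertical map
composed with the differential is a cocycle and factors through multiplication by `θ`
(`exists_vertical_lift`, `exists_last_lift`). The maps to the `F_i` are unique because the `L_a` are
independent and the `e_a ∧ w` span (`ψ_unique`). So the quadrics, and with them `I_f`, do not depend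
on the extension.

Commutativity of the last square says that the quadric of `w ∈ ⋀^p G` is `∑ L_a · α(e_a ∧ w)`. The
generic quadric of `η` is `∑ e_a* · i_{e_a} η`, which `φ` sends to `∑ L_a · α((i_{e_a} η) ⌟ ω)`. As
`e_a ∧ ω = 0`, one has `(i_{e_a} η) ⌟ ω = e_a ∧ (η ⌟ ω)` (`ι_mul_contract`), so the two agree for `w
= η ⌟ ω`. Every `w` has this form (`exists_contract_eq`), which gives equality of the spaces of
quadrics. The cone statement follows by factoring `φ` through its image. -/

noncomputable section

open scoped TensorProduct

namespace GenSyz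

/-! ### Contraction in the exterior algebra and the duality between multivectors of `G*` and of `G`.
-/

section ExteriorLemmas

variable {G : Type} [AddCommGroup G] [Module ℂ G]

lemma contractLeft_ι_mul (ξ : Module.Dual ℂ G) (g : G) (x : ExteriorAlgebra ℂ G) :
    CliffordAlgebra.contractLeft (Q := (0 : QuadraticForm ℂ G)) ξ (ExteriorAlgebra.ι ℂ g * x) =
      ξ g • x - ExteriorAlgebra.ι ℂ g *
        CliffordAlgebra.contractLeft (Q := (0 : QuadraticForm ℂ G)) ξ x :=
  CliffordAlgebra.contractLeft_ι_mul (Q := (0 : QuadraticForm ℂ G)) ξ g x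

lemma contract_ι_mul (ξ : Module.Dual ℂ G) (η : ExteriorAlgebra ℂ (Module.Dual ℂ G))
    (x : ExteriorAlgebra ℂ G) : contract G (ExteriorAlgebra.ι ℂ ξ * η) x =
      CliffordAlgebra.contractLeft (Q := (0 : QuadraticForm ℂ G)) ξ (contract G η x) := by
  rw [map_mul, contract, ExteriorAlgebra.lift_ι_apply]
  rfl

/-- If `g ∧ x = 0`, then wedging a contraction of `x` with `g` amounts to contracting `x` with
the contraction of the multivector by `g`. -/
lemma ι_mul_contract {g : G} {x : ExteriorAlgebra ℂ G} (hx : ExteriorAlgebra.ι ℂ g * x = 0)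
    (η : ExteriorAlgebra ℂ (Module.Dual ℂ G)) :
    ExteriorAlgebra.ι ℂ g * contract G η x =
      contract G (CliffordAlgebra.contractLeft (Q := (0 : QuadraticForm ℂ (Module.Dual ℂ G)))
        (Module.Dual.eval ℂ G g) η) x := by
  induction η using CliffordAlgebra.left_induction with
  -- The hypothesis `g ∧ x = 0` is needed only for scalars; the other cases propagate it.
  | algebraMap r =>
    rw [CliffordAlgebra.contractLeft_algebraMap, map_zero, LinearMap.zero_apply]
    erw [AlgHom.commutes]
    rw [Module.algebraMap_end_apply, mul_smul_comm, hx, smul_zero]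
  | add a b ha hb => simp only [map_add, LinearMap.add_apply, mul_add, ha, hb]
  | ι_mul η ξ ih =>
    change ExteriorAlgebra.ι ℂ g * contract G (ExteriorAlgebra.ι ℂ ξ * η) x =
      contract G (CliffordAlgebra.contractLeft (Q := (0 : QuadraticForm ℂ (Module.Dual ℂ G))) _
        (ExteriorAlgebra.ι ℂ ξ * η)) x
    -- Both `i_g` on `ξ ∧ η` and `i_ξ` on `g ∧ (η ⌟ x)` are expanded as antiderivations; the two
    -- terms `ξ(g) · (η ⌟ x)` cancel.
    rw [contractLeft_ι_mul, map_sub, LinearMap.sub_apply, contract_ι_mul, contract_ι_mul, ← ih,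
      contractLeft_ι_mul, map_smul, LinearMap.smul_apply, Module.Dual.eval_apply, sub_sub_cancel]

variable {ι : Type} [Fintype ι]

/-- Euler's identity for the exterior algebra: moving `e_a` past `g` in `g ∧ b` cancels the sign of
the antiderivation, and the term `∑ e_a*(g) e_a ∧ b = g ∧ b` adds one to the degree of `b`. -/
lemma sum_ι_mul_contractLeft (e : Module.Basis ι ℂ G) {m : ℕ} {x : ExteriorAlgebra ℂ G}
    (hx : x ∈ ⋀[ℂ]^m G) :
    ∑ a, ExteriorAlgebra.ι ℂ (e a) *
      CliffordAlgebra.contractLeft (Q := (0 : QuadraticForm ℂ G)) (e.coord a) x = (m : ℂ) • x := by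
  induction m generalizing x with
  | zero =>
    rw [ExteriorAlgebra.exteriorPower, pow_zero] at hx
    obtain ⟨c, rfl⟩ := Submodule.mem_one.1 hx
    simp [CliffordAlgebra.contractLeft_algebraMap]
  | succ m ih =>
    rw [ExteriorAlgebra.exteriorPower, pow_succ'] at hx
    induction hx using Submodule.mul_induction_on' with
    | mem_mul_mem a ha b hb =>
      obtain ⟨g, rfl⟩ := ha
      have anti (h : G) (y : ExteriorAlgebra ℂ G) : ExteriorAlgebra.ι ℂ h *
          (ExteriorAlgebra.ι ℂ g * y) = - (ExteriorAlgebra.ι ℂ g * (ExteriorAlgebra.ι ℂ h * y)) := by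
        rw [← mul_assoc, ← mul_assoc, ← neg_mul,
          eq_neg_of_add_eq_zero_left (ExteriorAlgebra.ι_add_mul_swap h g)]
      simp only [contractLeft_ι_mul, mul_sub, anti, sub_neg_eq_add, Finset.sum_add_distrib,
        ← Finset.mul_sum, ih hb, mul_smul_comm]
      rw [Nat.cast_succ, add_smul, one_smul, add_comm]
      congr 1
      conv_rhs => rw [← e.sum_repr g, map_sum, Finset.sum_mul]
      simp
    | add a _ b _ iha ihb =>
      simp only [map_add, mul_add, Finset.sum_add_distrib, iha, ihb, smul_add]

variable (G) in
lemma ι_mul_eq_zero_of_finrank [Module.Finite ℂ G] {m : ℕ} (hm : Module.finrank ℂ G = m) (g : G)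
    {x : ExteriorAlgebra ℂ G} (hx : x ∈ ⋀[ℂ]^m G) : ExteriorAlgebra.ι ℂ g * x = 0 := by
  have : Subsingleton (⋀[ℂ]^(m + 1) G) := by
    rw [← Module.finrank_zero_iff (R := ℂ), exteriorPower.finrank_eq, hm]
    simp
  exact congrArg Subtype.val (Subsingleton.elim (wedge m g ⟨x, hx⟩) 0)

/-- The duality between `⋀^k G*` and `⋀^m G`, for `m + k = dim G`. -/
lemma exists_contract_eq [Module.Finite ℂ G] {d : ℕ} (hd : Module.finrank ℂ G = d)
    {ω : ExteriorAlgebra ℂ G} (hω : ω ∈ ⋀[ℂ]^d G) (h0 : ω ≠ 0) {j k : ℕ} (hjk : j + k = d)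
    {w : ExteriorAlgebra ℂ G} (hw : w ∈ ⋀[ℂ]^j G) :
    ∃ η ∈ ⋀[ℂ]^k (Module.Dual ℂ G), contract G η ω = w := by
  let e := Module.finBasis ℂ G
  -- Nondegeneracy: if all `i_{e_a*}` killed a multivector of positive degree, Euler's identity
  -- would make a nonzero multiple of it vanish.
  have key : ∀ (k j : ℕ) (x : ExteriorAlgebra ℂ G), x ∈ ⋀[ℂ]^(j + k) G → x ≠ 0 →
      ∃ η ∈ ⋀[ℂ]^k (Module.Dual ℂ G), contract G η x ≠ 0 := by
    intro k
    induction k with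
    | zero =>
      intro j x _ hx
      exact ⟨1, by rw [ExteriorAlgebra.exteriorPower, pow_zero]; exact Submodule.mem_one.2 ⟨1, map_one _⟩,
        by simpa using hx⟩
    | succ k ih =>
      intro j x hx hx0
      obtain ⟨η, hη, h⟩ := ih (j + 1) x (by rwa [add_assoc, add_comm 1 k]) hx0
      have hm := contract_mem (m := j + 1) hη (by rwa [add_assoc, add_comm 1 k])
      by_contra! hc
      have hz : ∀ a, CliffordAlgebra.contractLeft (Q := (0 : QuadraticForm ℂ G)) (e.coord a)
          (contract G η x) = 0 := by
        intro a
        rw [← contract_ι_mul]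
        refine hc _ ?_
        rw [ExteriorAlgebra.exteriorPower, pow_succ']
        exact Submodule.mul_mem_mul (LinearMap.mem_range_self _ _) hη
      have := sum_ι_mul_contractLeft e hm
      simp only [hz, mul_zero, Finset.sum_const_zero] at this
      rcases smul_eq_zero.1 this.symm with h' | h'
      · exact Nat.cast_ne_zero.2 (Nat.succ_ne_zero j) h'
      · exact h h'
  induction j generalizing w k with
  | zero =>
    obtain ⟨η, hη, h⟩ := key k 0 ω (by rwa [hjk]) h0
    have hm := contract_mem (m := 0) hη (x := ω) (by rwa [hjk])
    rw [ExteriorAlgebra.exteriorPower, pow_zero] at hm hw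
    obtain ⟨c, hc⟩ := Submodule.mem_one.1 hm
    obtain ⟨b, rfl⟩ := Submodule.mem_one.1 hw
    have hc0 : c ≠ 0 := by
      rintro rfl
      exact h (by rw [← hc, map_zero])
    -- Here `η ⌟ ω` is the nonzero scalar `c`, so rescaling reaches any scalar `b`.
    refine ⟨(b / c) • η, Submodule.smul_mem _ _ hη, ?_⟩
    rw [map_smul, LinearMap.smul_apply, ← hc, ← algebraMap_smul ℂ (b / c), Algebra.smul_def,
      ← map_mul]
    simp [hc0]
  | succ j ih =>
    rw [ExteriorAlgebra.exteriorPower, pow_succ'] at hw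
    induction hw using Submodule.mul_induction_on' with
    | mem_mul_mem a ha b hb =>
      obtain ⟨g, rfl⟩ := ha
      obtain ⟨η, hη, rfl⟩ := ih (k := k + 1) (by omega) hb
      -- The witness for `g ∧ (η ⌟ ω)` is `i_g η`, since `g ∧ ω = 0` in top degree.
      exact ⟨_, contractLeft_mem _ hη,
        (ι_mul_contract (ι_mul_eq_zero_of_finrank G hd g hω) η).symm⟩
    | add a _ b _ iha ihb =>
      obtain ⟨η, hη, rfl⟩ := iha
      obtain ⟨η', hη', rfl⟩ := ihb
      exact ⟨η + η', add_mem hη hη', by simp⟩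

/-- Has the same signs as `comult_ιMulti`, so that `comult` can be rewritten through contractions.
-/
lemma contractLeft_ιMulti (ξ : Module.Dual ℂ G) (k : ℕ) (v : Fin (k + 1) → G) :
    CliffordAlgebra.contractLeft (Q := (0 : QuadraticForm ℂ G)) ξ
        (ExteriorAlgebra.ιMulti ℂ (k + 1) v) =
      ∑ i : Fin (k + 1), (-1 : ℤ) ^ (i : ℕ) •
        (ξ (v i) • ExteriorAlgebra.ιMulti ℂ k fun j => v (i.succAbove j)) := by
  induction k with
  | zero =>
    rw [ExteriorAlgebra.ιMulti_succ_apply, contractLeft_ι_mul, ExteriorAlgebra.ιMulti_zero_apply,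
      CliffordAlgebra.contractLeft_one]
    simp
  | succ k ih =>
    rw [ExteriorAlgebra.ιMulti_succ_apply, contractLeft_ι_mul, ih,
      Fin.sum_univ_succ (n := k + 1), Finset.mul_sum, sub_eq_add_neg, ← Finset.sum_neg_distrib]
    congr 1
    · simp [Matrix.vecTail, Function.comp_def]
    · refine Finset.sum_congr rfl fun i _ => ?_
      rw [ExteriorAlgebra.ιMulti_succ_apply]
      simp only [Matrix.vecTail, Function.comp_def, pow_succ, zsmul_eq_mul,
        Int.cast_pow, Int.cast_neg, Int.cast_one, mul_smul_comm, Fin.val_succ, mul_neg, mul_one,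
        neg_mul, Fin.succ_succAbove_zero, Fin.succ_succAbove_succ]
      rw [← mul_assoc, ← mul_assoc, ((Commute.neg_one_left _).pow_left _).eq, smul_neg]

end ExteriorLemmas

/-! ### Contraction and wedge product as maps between exterior powers. -/

section Interior

variable {G : Type} [AddCommGroup G] [Module ℂ G]

/-- Contraction `⋀^(m+1) G → ⋀^m G` with a linear form. -/
def interior (m : ℕ) (ξ : Module.Dual ℂ G) : ⋀[ℂ]^(m + 1) G →ₗ[ℂ] ⋀[ℂ]^m G :=
  LinearMap.restrict (CliffordAlgebra.contractLeft (Q := (0 : QuadraticForm ℂ G)) ξ)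
    fun _ hx => contractLeft_mem ξ hx

lemma interior_wedge (m : ℕ) (ξ : Module.Dual ℂ G) (g : G) (w : ⋀[ℂ]^(m + 1) G) :
    interior (m + 1) ξ (wedge (m + 1) g w) = ξ g • w - wedge m g (interior m ξ w) :=
  Subtype.ext (contractLeft_ι_mul ξ g w.1)

lemma sum_wedge_interior {ι : Type} [Fintype ι] (e : Module.Basis ι ℂ G) (m : ℕ)
    (w : ⋀[ℂ]^(m + 1) G) :
    ∑ a, wedge m (e a) (interior m (e.coord a) w) = ((m + 1 : ℕ) : ℂ) • w := by
  apply Subtype.ext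
  rw [AddSubmonoidClass.coe_finsetSum]
  exact sum_ι_mul_contractLeft e w.2

end Interior

/-! ### Euler operators and exactness of the Koszul complex. -/

section Koszul

open MvPolynomial

variable {n : ℕ}

/-- The derivative in the direction of a linear form on the space of linear forms. -/
def dirDeriv (r : Module.Dual ℂ (LinForms n)) : Derivation ℂ (CoordRing n) (CoordRing n) :=
  ∑ i, r ⟨X i, isHomogeneous_X ℂ i⟩ • pderiv i

lemma linForm_mul_mem (v : LinForms n) {d : ℕ} {p : CoordRing n} (hp : p ∈ coordGrading n d) :
    v.1 * p ∈ coordGrading n (d + 1) :=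
  add_comm 1 d ▸ SetLike.GradedMul.mul_mem v.2 hp

lemma dirDeriv_apply (r : Module.Dual ℂ (LinForms n)) (p : CoordRing n) :
    dirDeriv r p = ∑ i, r ⟨X i, isHomogeneous_X ℂ i⟩ • pderiv i p := by
  rw [dirDeriv, ← Derivation.coeFnAddMonoidHom_apply, map_sum, Finset.sum_apply]
  rfl

lemma dirDeriv_X (r : Module.Dual ℂ (LinForms n)) (i : Fin (n + 1)) :
    dirDeriv r (X i) = C (r ⟨X i, isHomogeneous_X ℂ i⟩) := by
  rw [dirDeriv_apply, Finset.sum_eq_single i]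
  · rw [pderiv_X_self, smul_eq_C_mul, mul_one]
  · intro j _ hj
    rw [pderiv_X_of_ne hj.symm, smul_zero]
  · simp

lemma dirDeriv_linForm (r : Module.Dual ℂ (LinForms n)) (v : LinForms n) :
    dirDeriv r v.1 = C (r v) := by
  obtain ⟨v, hv⟩ := v
  have hv' := hv
  rw [coordGrading, homogeneousSubmodule_one_eq_span_X] at hv'
  induction hv' using Submodule.span_induction with
  | mem x hx => obtain ⟨i, rfl⟩ := hx; exact dirDeriv_X r i
  | zero => simp [show (⟨0, hv⟩ : LinForms n) = 0 from rfl]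
  | add x y hx hy ihx ihy =>
    rw [← homogeneousSubmodule_one_eq_span_X] at hx hy
    rw [map_add, ihx hx, ihy hy, ← C_add, ← map_add]
    rfl
  | smul c x hx ih =>
    rw [← homogeneousSubmodule_one_eq_span_X] at hx
    rw [Derivation.map_smul, ih hx, smul_eq_C_mul, ← C_mul, ← smul_eq_mul, ← map_smul]
    rfl

lemma dirDeriv_mem (r : Module.Dual ℂ (LinForms n)) {d : ℕ} {p : CoordRing n}
    (hp : p ∈ coordGrading n (d + 1)) : dirDeriv r p ∈ coordGrading n d := by
  rw [dirDeriv_apply]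
  exact Submodule.sum_mem _ fun i _ => Submodule.smul_mem _ _ (IsHomogeneous.pderiv hp)

lemma dirDeriv_of_mem_zero (r : Module.Dual ℂ (LinForms n)) {p : CoordRing n}
    (hp : p ∈ coordGrading n 0) : dirDeriv r p = 0 := by
  rw [coordGrading, homogeneousSubmodule_zero] at hp
  obtain ⟨c, rfl⟩ := Submodule.mem_one.1 hp
  exact (dirDeriv r).map_algebraMap c

lemma dirDeriv_comm (r s : Module.Dual ℂ (LinForms n)) (p : CoordRing n) :
    dirDeriv r (dirDeriv s p) = dirDeriv s (dirDeriv r p) := by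
  have : ⁅dirDeriv r, dirDeriv s⁆ = 0 := by
    apply MvPolynomial.derivation_ext
    intro i
    rw [Derivation.commutator_apply, dirDeriv_X, dirDeriv_X]
    simp
  rw [← sub_eq_zero, ← Derivation.commutator_apply, this, Derivation.zero_apply]

variable {ι : Type} [Fintype ι] (L : ι → LinForms n) (r : ι → Module.Dual ℂ (LinForms n))

/-- The Euler operator of a family of linear forms `L` and a dual family `r`. -/
def euler : Derivation ℂ (CoordRing n) (CoordRing n) := ∑ a, (L a).1 • dirDeriv (r a)

lemma euler_apply (p : CoordRing n) : euler L r p = ∑ a, (L a).1 * dirDeriv (r a) p := by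
  rw [euler, ← Derivation.coeFnAddMonoidHom_apply, map_sum, Finset.sum_apply]
  rfl

lemma euler_mem {d : ℕ} {p : CoordRing n} (hp : p ∈ coordGrading n d) :
    euler L r p ∈ coordGrading n d := by
  rw [euler_apply]
  refine Submodule.sum_mem _ fun a _ => ?_
  cases d with
  | zero => rw [dirDeriv_of_mem_zero _ hp, mul_zero]; exact zero_mem _
  | succ d =>
    exact linForm_mul_mem (L a) (dirDeriv_mem (r a) hp)

variable {L r} [DecidableEq ι] (hr : ∀ a b, r a (L b) = if a = b then 1 else 0)
include hr

/-- The derivations `dirDeriv` commute with each other, so only the derivatives of the coefficients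
`L_b` contribute to the commutator, and by duality they leave `dirDeriv (r a)`. -/
lemma dirDeriv_euler (a : ι) (p : CoordRing n) :
    dirDeriv (r a) (euler L r p) = dirDeriv (r a) p + euler L r (dirDeriv (r a) p) := by
  simp only [euler_apply, map_sum, Derivation.leibniz, dirDeriv_linForm, hr, smul_eq_mul,
    Finset.sum_add_distrib, dirDeriv_comm (r a)]
  rw [add_comm]
  congr 1
  simp [apply_ite C]

lemma euler_linForm (a : ι) : euler L r (L a).1 = L a := by
  simp [euler_apply, dirDeriv_linForm, hr, apply_ite C]

/-- The Euler operator has no negative integer eigenvalue. Differentiating raises the constant by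
one and lowers the degree, so by induction all derivatives of `p` along the `r a` vanish; then the
Euler term is zero and only the nonzero multiple of `p` is left. -/
lemma eq_zero_of_euler_add_smul {d c : ℕ} {p : CoordRing n} (hp : p ∈ coordGrading n d)
    (h : euler L r p + ((c + 1 : ℕ) : ℂ) • p = 0) : p = 0 := by
  induction d generalizing c p with
  | zero =>
    simp only [euler_apply, dirDeriv_of_mem_zero _ hp, mul_zero, Finset.sum_const_zero,
      zero_add] at h
    exact (smul_eq_zero.1 h).resolve_left (Nat.cast_ne_zero.2 (Nat.succ_ne_zero c))
  | succ d ih =>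
    have hz : ∀ a, dirDeriv (r a) p = 0 := by
      intro a
      have h1 := congrArg (dirDeriv (r a)) h
      rw [map_add, dirDeriv_euler hr, Derivation.map_smul, map_zero] at h1
      refine ih (c := c + 1) (dirDeriv_mem (r a) hp) ?_
      rw [← h1, Nat.cast_succ (c + 1), add_smul, one_smul]
      abel
    simp only [euler_apply, hz, mul_zero, Finset.sum_const_zero, zero_add] at h
    exact (smul_eq_zero.1 h).resolve_left (Nat.cast_ne_zero.2 (Nat.succ_ne_zero c))

/-- An injective endomorphism of the finite-dimensional space of forms of degree `d` is bijective;
`S` is its inverse. -/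
lemma exists_euler_add_smul_eq (d c : ℕ) :
    ∃ S : coordGrading n d →ₗ[ℂ] coordGrading n d,
      ∀ p, euler L r (S p).1 + ((c + 1 : ℕ) : ℂ) • (S p).1 = p := by
  have : Module.Finite ℂ (coordGrading n d) :=
    Module.Finite.iff_fg.2 (homogeneousSubmodule_fg (Fin (n + 1)) ℂ d)
  let T : coordGrading n d →ₗ[ℂ] coordGrading n d :=
    LinearMap.codRestrict _ (((euler L r).toLinearMap +
      ((c + 1 : ℕ) : ℂ) • LinearMap.id).domRestrict _) fun p =>
        Submodule.add_mem _ (euler_mem L r p.2) (Submodule.smul_mem _ _ p.2)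
  have hT : Function.Injective T := by
    rw [injective_iff_map_eq_zero]
    intro p hp
    exact Subtype.ext (eq_zero_of_euler_add_smul hr p.2 (congrArg Subtype.val hp))
  exact ⟨(LinearEquiv.ofInjectiveEndo T hT).symm, fun p =>
    congrArg Subtype.val ((LinearEquiv.ofInjectiveEndo T hT).apply_symm_apply p)⟩

variable {G : Type} [AddCommGroup G] [Module ℂ G] (e : Module.Basis ι ℂ G)

/-- Exactness of the Koszul complex of a linearly independent family of linear forms. -/
lemma exists_koszul_lift {j d : ℕ} (m : ⋀[ℂ]^(j + 1) G →ₗ[ℂ] CoordRing n)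
    (hm : ∀ w, m w ∈ coordGrading n (d + 1))
    (h : ∀ w, ∑ a, (L a).1 * m (wedge j (e a) w) = 0) :
    ∃ m' : ⋀[ℂ]^(j + 1 + 1) G →ₗ[ℂ] coordGrading n d,
      ∀ w, m w = ∑ a, (L a).1 * (m' (wedge (j + 1) (e a) w)).1 := by
  -- `S` inverts Euler plus `j + 2`; multiplication by `L_a` turns this into Euler plus `j + 1`.
  obtain ⟨S, hS⟩ := exists_euler_add_smul_eq hr d (j + 1)
  -- The Koszul homotopy: contract the argument, differentiate the value.
  let u : ⋀[ℂ]^(j + 1 + 1) G →ₗ[ℂ] coordGrading n d :=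
    LinearMap.codRestrict _
      (∑ a, (dirDeriv (r a)).toLinearMap ∘ₗ m ∘ₗ interior (j + 1) (e.coord a)) (by
        intro w
        rw [LinearMap.sum_apply]
        exact Submodule.sum_mem _ fun a _ => dirDeriv_mem _ (hm _))
  have hu : ∀ w, (u w).1 = ∑ a, dirDeriv (r a) (m (interior (j + 1) (e.coord a) w)) := by
    intro w
    simp [u]
  have hsum : ∀ w, ∑ b, (L b).1 * (u (wedge (j + 1) (e b) w)).1 =
      euler L r (m w) + ((j + 1 : ℕ) : ℂ) • m w := by
    intro w
    -- The cocycle condition at `i_{e_a*} w`, differentiated along `r a` and summed. Its diagonal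
    -- part is `(j + 1) m(w)` by Euler's identity in the exterior algebra.
    have h1 : ∑ a, dirDeriv (r a) (∑ b, (L b).1 * m (wedge j (e b) (interior j (e.coord a) w))) =
        0 := by
      simp only [h, map_zero, Finset.sum_const_zero]
    simp only [map_sum, Derivation.leibniz, dirDeriv_linForm, hr, smul_eq_mul,
      Finset.sum_add_distrib] at h1
    have h2 : ∑ a, ∑ b, m (wedge j (e b) (interior j (e.coord a) w)) *
        C (if a = b then (1 : ℂ) else 0) = ((j + 1 : ℕ) : ℂ) • m w := by
      rw [← map_smul, ← sum_wedge_interior e, map_sum]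
      simp [apply_ite C]
    rw [h2] at h1
    rw [eq_neg_of_add_eq_zero_right h1, ← sub_eq_add_neg]
    simp only [hu, interior_wedge, map_sub, map_smul, Derivation.map_smul, Finset.mul_sum, mul_sub,
      Finset.sum_sub_distrib, euler_apply]
    rw [Finset.sum_comm (f := fun a b => (L b).1 * dirDeriv (r a) _)]
    have h3 : ∑ x, ∑ i, (L x).1 * (e.coord i) (e x) • dirDeriv (r i) (m w) =
        ∑ a, (L a).1 * dirDeriv (r a) (m w) := by
      refine Finset.sum_congr rfl fun a _ => ?_
      rw [Finset.sum_eq_single a] <;> simp +contextual [eq_comm]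
    rw [h3]
  refine ⟨S ∘ₗ u, fun w => ?_⟩
  -- The difference of the two sides is annihilated by Euler plus `j + 1`, which is injective.
  rw [← sub_eq_zero]
  refine eq_zero_of_euler_add_smul hr (c := j) (d := d + 1) (sub_mem (hm w) ?_) ?_
  · refine Submodule.sum_mem _ fun a _ => ?_
    exact linForm_mul_mem (L a) (SetLike.coe_mem _)
  · have h4 : ∀ a, (u (wedge (j + 1) (e a) w)).1 =
        euler L r ((S ∘ₗ u) (wedge (j + 1) (e a) w)).1 +
          ((j + 1 + 1 : ℕ) : ℂ) • ((S ∘ₗ u) (wedge (j + 1) (e a) w)).1 :=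
      fun a => (hS _).symm
    have h5 := hsum w
    simp only [h4, mul_add] at h5
    rw [map_sub, smul_sub, sub_add_sub_comm, ← h5, sub_eq_zero, map_sum, Finset.smul_sum,
      ← Finset.sum_add_distrib]
    refine Finset.sum_congr rfl fun a _ => ?_
    rw [Derivation.leibniz, euler_linForm hr, Nat.cast_succ (j + 1), add_smul, one_smul,
      mul_add, smul_eq_mul, smul_eq_mul, mul_smul_comm]
    ring

end Koszul

/-! ### Tensors in `V ⊗ W` and the smallest subspace of `W` that supports them. -/

section TensorContraction

variable {V W U : Type} [AddCommGroup V] [Module ℂ V] [AddCommGroup W] [Module ℂ W]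
  [AddCommGroup U] [Module ℂ U]

variable (V) in
/-- Contraction of the second factor of a tensor product with a linear form. -/
def tensorContract (ξ : Module.Dual ℂ W) : V ⊗[ℂ] W →ₗ[ℂ] V :=
  (TensorProduct.rid ℂ V).toLinearMap ∘ₗ LinearMap.lTensor V ξ

@[simp]
lemma tensorContract_tmul (ξ : Module.Dual ℂ W) (v : V) (w : W) :
    tensorContract V ξ (v ⊗ₜ w) = ξ w • v := by
  simp [tensorContract]

variable {ι : Type} [Fintype ι]

lemma sum_tensorContract_tmul (e : Module.Basis ι ℂ W) (t : V ⊗[ℂ] W) :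
    ∑ c, tensorContract V (e.coord c) t ⊗ₜ[ℂ] e c = t := by
  induction t with
  | zero => simp
  | add x y hx hy => simp only [map_add, TensorProduct.add_tmul, Finset.sum_add_distrib, hx, hy]
  | tmul v w =>
    simp only [tensorContract_tmul, TensorProduct.smul_tmul]
    rw [← TensorProduct.tmul_sum]
    simp only [Module.Basis.coord_apply, e.sum_repr]

lemma tensor_ext (e : Module.Basis ι ℂ W) {s t : V ⊗[ℂ] W}
    (h : ∀ c, tensorContract V (e.coord c) s = tensorContract V (e.coord c) t) : s = t := by
  rw [← sum_tensorContract_tmul e s, ← sum_tensorContract_tmul e t]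
  simp only [h]

variable {κ : Type} [DecidableEq κ] (v : Module.Basis κ ℂ V)

lemma equivFinsuppOfBasisLeft_lTensor (h : U →ₗ[ℂ] W) (t : V ⊗[ℂ] U) (i : κ) :
    TensorProduct.equivFinsuppOfBasisLeft v (LinearMap.lTensor V h t) i =
      h (TensorProduct.equivFinsuppOfBasisLeft v t i) := by
  induction t with
  | zero => simp
  | add x y hx hy => simp only [map_add, Finsupp.add_apply, hx, hy]
  | tmul x y => simp

lemma mem_range_lTensor_iff (G : Submodule ℂ W) (t : V ⊗[ℂ] W) :
    t ∈ LinearMap.range (LinearMap.lTensor V G.subtype) ↔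
      ∀ i, TensorProduct.equivFinsuppOfBasisLeft v t i ∈ G := by
  constructor
  · rintro ⟨s, rfl⟩ i
    rw [equivFinsuppOfBasisLeft_lTensor]
    exact SetLike.coe_mem _
  · intro h
    rw [← (TensorProduct.equivFinsuppOfBasisLeft v).symm_apply_apply t,
      TensorProduct.equivFinsuppOfBasisLeft_symm_apply]
    exact Submodule.sum_mem _ fun i _ => ⟨v i ⊗ₜ ⟨_, h i⟩, by simp⟩

/-- Lying in `V ⊗ G` means that all coordinates along a basis of `V` lie in `G`, a condition stable
under intersections. So the smallest `G` does support `t`. -/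
lemma mem_range_lTensor_sInf (t : V ⊗[ℂ] W) :
    t ∈ LinearMap.range (LinearMap.lTensor V
      (sInf {G : Submodule ℂ W | t ∈ LinearMap.range (LinearMap.lTensor V G.subtype)}).subtype) := by
  classical
  let v := Module.Free.chooseBasis ℂ V
  rw [mem_range_lTensor_iff v]
  intro i
  rw [Submodule.mem_sInf]
  intro G hG
  exact (mem_range_lTensor_iff v G t).1 hG i

/-- If `ξ` kills `θ`, then `ker ξ` already supports `t`, so by minimality it is all of `G`. -/
lemma eq_zero_of_tensorContract_eq_zero {t : V ⊗[ℂ] W} {G : Submodule ℂ W}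
    (hG : G = sInf {G : Submodule ℂ W | t ∈ LinearMap.range (LinearMap.lTensor V G.subtype)})
    {θ : V ⊗[ℂ] G} (hθ : LinearMap.lTensor V G.subtype θ = t) {ξ : Module.Dual ℂ G}
    (h : tensorContract V ξ θ = 0) : ξ = 0 := by
  classical
  let v := Module.Free.chooseBasis ℂ V
  have h0 : LinearMap.lTensor V ξ θ = 0 := (TensorProduct.rid ℂ V).map_eq_zero_iff.1 h
  have hle : G ≤ (LinearMap.ker ξ).map G.subtype := by
    conv_lhs => rw [hG]
    refine sInf_le ((mem_range_lTensor_iff v _ t).2 fun i => ?_)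
    rw [← hθ, equivFinsuppOfBasisLeft_lTensor]
    refine Submodule.mem_map_of_mem ?_
    rw [LinearMap.mem_ker, ← equivFinsuppOfBasisLeft_lTensor, h0]
    simp
  ext x
  obtain ⟨y, hy, hyx⟩ := hle x.2
  rw [← Subtype.ext (p := (· ∈ G)) hyx]
  exact hy

end TensorContraction

/-! ### The Koszul differential in a basis. -/

section WedgeLemmas

variable {G V : Type} [AddCommGroup G] [Module ℂ G] [AddCommGroup V] [Module ℂ V]
  {ι : Type} [Fintype ι]

lemma koszul_eq_sum (e : Module.Basis ι ℂ G) (θ : V ⊗[ℂ] G) (j : ℕ) (w : ⋀[ℂ]^j G) :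
    koszul θ j w = ∑ c, tensorContract V (e.coord c) θ ⊗ₜ[ℂ] wedge j (e c) w := by
  conv_lhs => rw [← sum_tensorContract_tmul e θ]
  simp [koszul]

/-- By Euler's identity `(j + 1) w` is a sum of terms `e_a ∧ w'`, and `j + 1` is invertible in `ℂ`.
-/
lemma exteriorPower_linearMap_ext (e : Module.Basis ι ℂ G) {j : ℕ} {f g : ⋀[ℂ]^(j + 1) G →ₗ[ℂ] V}
    (h : ∀ c w, f (wedge j (e c) w) = g (wedge j (e c) w)) : f = g := by
  refine LinearMap.ext fun w => ?_
  have h1 := sum_wedge_interior e j w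
  have h2 : ((j + 1 : ℕ) : ℂ) • f w = ((j + 1 : ℕ) : ℂ) • g w := by
    rw [← map_smul, ← map_smul, ← h1, map_sum, map_sum]
    simp only [h]
  exact smul_right_injective V (Nat.cast_ne_zero.2 (Nat.succ_ne_zero j)) h2

end WedgeLemmas

/-! ### The linear strand is a complex. -/

namespace MinimalFreeResolution

open MvPolynomial

variable {n : ℕ} {I : Ideal (CoordRing n)} (F : MinimalFreeResolution I)

/-- In the case of equal degrees the entry is a constant, which minimality forces to be zero. -/
lemma diff_eq_zero_of_le {i : ℕ} {b : Fin (F.rk (i + 1))} {a : Fin (F.rk i)}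
    (h : F.deg (i + 1) b ≤ F.deg i a) : F.diff i (Pi.single b 1) a = 0 := by
  rcases h.lt_or_eq with h | h
  · exact F.diff_eq_zero i b a h
  · have h0 : F.diff i (Pi.single b 1) a ∈ homogeneousSubmodule (Fin (n + 1)) ℂ 0 :=
      F.diff_homogeneous i b a 0 (by rw [h, add_zero])
    rw [homogeneousSubmodule_zero] at h0
    obtain ⟨c, hc⟩ := Submodule.mem_one.1 h0
    have := F.minimal i b a
    rw [← hc, algebraMap_eq, constantCoeff_C] at this
    rw [← hc, this, map_zero]

lemma sum_linIndex {M : Type} [AddCommMonoid M] (i : ℕ) (g : Fin (F.rk i) → M)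
    (h : ∀ c, F.deg i c ≠ i + 2 → g c = 0) : ∑ c, g c = ∑ c : F.LinIndex i, g c.1 := by
  rw [← Finset.sum_subtype (Finset.univ.filter fun c => F.deg i c = i + 2) (by simp) g]
  exact (Finset.sum_filter_of_ne fun c _ hc => by_contra fun h' => hc (h c h')).symm

lemma map_eq_sum {k : ℕ} {M : Type} [AddCommGroup M] [Module (CoordRing n) M]
    (h : (Fin k → CoordRing n) →ₗ[CoordRing n] M) (y : Fin k → CoordRing n) :
    h y = ∑ c, y c • h (Pi.single c 1) := by
  conv_lhs => rw [← LinearMap.sum_single_apply (fun _ => CoordRing n) y, map_sum]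
  refine Finset.sum_congr rfl fun c _ => ?_
  rw [← map_smul]
  congr 1
  simp [← Pi.single_smul]

/-- The coordinate of an element of `V ⊗ F_i` at a generator. -/
def tensorCoord (i : ℕ) (a : F.LinIndex i) : LinForms n ⊗[ℂ] F.LinSyz i →ₗ[ℂ] LinForms n :=
  tensorContract (LinForms n) ((Pi.basisFun ℂ (F.LinIndex i)).coord a)

lemma tensorCoord_linDiff (i : ℕ) (x : F.LinSyz (i + 1)) (a : F.LinIndex i) :
    F.tensorCoord i a (F.linDiff i x) = ∑ b, x b • F.linEntry i b a := by
  simp [tensorCoord, linDiff, Pi.single_apply]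

lemma linAug_apply (x : F.LinSyz 0) :
    F.linAug x = ∑ b : F.LinIndex 0, x b • F.aug (Pi.single b.1 1) := by
  simp [linAug]

lemma linDiff_linDiff (i : ℕ) (x : F.LinSyz (i + 1 + 1)) (a : F.LinIndex i) :
    ∑ b, (F.tensorCoord (i + 1) b (F.linDiff (i + 1) x)).1 * (F.linEntry i b a).1 = 0 := by
  have key : ∀ b' : F.LinIndex (i + 1 + 1),
      ∑ b, (F.linEntry (i + 1) b' b).1 * (F.linEntry i b a).1 = 0 := by
    intro b'
    have h0 : F.diff i (F.diff (i + 1) (Pi.single b'.1 1)) = 0 :=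
      (F.exact_diff i _).2 ⟨_, rfl⟩
    have h1 := congrFun h0 a.1
    rw [map_eq_sum, Finset.sum_apply, F.sum_linIndex] at h1
    · exact h1
    · intro c hc
      have := b'.2
      have := a.2
      -- Paths through a generator `c` of degree other than `i + 3` contribute nothing: in degree at
      -- least `i + 4` the entry into `c` vanishes, in degree at most `i + 2` the entry out of it.
      rcases le_or_gt (F.deg (i + 1 + 1) b'.1) (F.deg (i + 1) c) with h | h
      · rw [F.diff_eq_zero_of_le h, zero_smul, Pi.zero_apply]
      · have h' : F.deg (i + 1) c ≤ F.deg i a.1 := by omega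
        rw [Pi.smul_apply, F.diff_eq_zero_of_le h', smul_zero]
  simp only [tensorCoord_linDiff, AddSubmonoidClass.coe_finsetSum, Finset.sum_mul]
  rw [Finset.sum_comm]
  refine Finset.sum_eq_zero fun b' _ => ?_
  simp only [Submodule.coe_smul, smul_mul_assoc]
  rw [← Finset.smul_sum, key, smul_zero]

lemma eq_zero_of_mem_span_quadrics {Q : Set (CoordRing n)} (hQ : ∀ x ∈ Q, x.IsHomogeneous 2)
    {p : CoordRing n} (hp : p ∈ Ideal.span Q) {d : ℕ} (hd : p.IsHomogeneous d) (h2 : d < 2) :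
    p = 0 := by
  have h : ∀ m : Fin (n + 1) →₀ ℕ, m.degree < 2 → coeff m p = 0 := by
    clear hd
    induction hp using Submodule.span_induction with
    | mem x hx => exact fun m hm => (hQ x hx).coeff_eq_zero hm.ne
    | zero => simp
    | add x y _ _ hx hy => intro m hm; rw [coeff_add, hx m hm, hy m hm, add_zero]
    | smul r x _ hx =>
      intro m hm
      rw [smul_eq_mul, coeff_mul]
      refine Finset.sum_eq_zero fun ab hab => ?_
      rw [hx ab.2, mul_zero]
      rw [← Finset.HasAntidiagonal.mem_antidiagonal.1 hab, map_add] at hm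
      omega
  ext m
  by_cases hm : m.degree = d
  · exact h m (hm ▸ h2)
  · rw [hd.coeff_eq_zero hm, coeff_zero]

lemma linAug_linDiff (hI : ∃ Q : Set (CoordRing n), (∀ x ∈ Q, x.IsHomogeneous 2) ∧ I = Ideal.span Q)
    (x : F.LinSyz (0 + 1)) :
    ∑ b, (F.tensorCoord 0 b (F.linDiff 0 x)).1 * F.aug (Pi.single b.1 1) = 0 := by
  obtain ⟨Q, hQ, hIQ⟩ := hI
  have key : ∀ b' : F.LinIndex (0 + 1),
      ∑ b, (F.linEntry 0 b' b).1 * F.aug (Pi.single b.1 1) = 0 := by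
    intro b'
    have h1 : F.aug (F.diff 0 (Pi.single b'.1 1)) = 0 := (F.exact_aug _).2 ⟨_, rfl⟩
    rw [map_eq_sum, F.sum_linIndex] at h1
    · exact h1
    · intro c hc
      have := b'.2
      rcases le_or_gt (F.deg (0 + 1) b'.1) (F.deg 0 c) with h | h
      · rw [F.diff_eq_zero_of_le h, zero_smul]
      -- Minimality says nothing about the augmentation; here `c` has degree below 2, where an ideal
      -- generated by quadrics is zero.
      · rw [eq_zero_of_mem_span_quadrics hQ (p := F.aug (Pi.single c 1)) ?_
          (F.aug_homogeneous c) (by omega), smul_zero]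
        exact hIQ.le (F.range_aug.le (LinearMap.mem_range_self _ _))
  simp only [tensorCoord_linDiff, AddSubmonoidClass.coe_finsetSum, Finset.sum_mul]
  rw [Finset.sum_comm]
  refine Finset.sum_eq_zero fun b' _ => ?_
  simp only [Submodule.coe_smul, smul_mul_assoc]
  rw [← Finset.smul_sum, key, smul_zero]

end MinimalFreeResolution

/-! ### Existence and uniqueness of the extension to the Koszul complex. -/

section Extension

open MinimalFreeResolution

variable {n : ℕ} {I : Ideal (CoordRing n)} {F : MinimalFreeResolution I} {q : ℕ}
  {f : F.LinSyz (q + 1)}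

lemma exists_lTensor_involved (f : F.LinSyz (q + 1)) :
    ∃ θ : LinForms n ⊗[ℂ] involved f,
      LinearMap.lTensor (LinForms n) (involved f).subtype θ = F.linDiff q f :=
  mem_range_lTensor_sInf (F.linDiff q f)

lemma lTensor_involved_injective (f : F.LinSyz (q + 1)) :
    Function.Injective (LinearMap.lTensor (LinForms n) (involved f).subtype) :=
  Module.Flat.lTensor_preserves_injective_linearMap _ (involved f).injective_subtype

/-- The linear forms involved in a linear syzygy are linearly independent. -/
lemma exists_dual_family {ι : Type} [DecidableEq ι] (e : Module.Basis ι ℂ (involved f))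
    {θ : LinForms n ⊗[ℂ] involved f}
    (hθ : LinearMap.lTensor (LinForms n) (involved f).subtype θ = F.linDiff q f) :
    ∃ r : ι → Module.Dual ℂ (LinForms n),
      ∀ a b, r a (tensorContract (LinForms n) (e.coord b) θ) = if a = b then 1 else 0 := by
  let lin : Module.Dual ℂ (involved f) →ₗ[ℂ] LinForms n :=
    (TensorProduct.rid ℂ (LinForms n)).toLinearMap ∘ₗ (LinearMap.lTensorHom (LinForms n)).flip θ
  have hlin : LinearMap.ker lin = ⊥ := by
    rw [LinearMap.ker_eq_bot']
    exact fun ξ h => eq_zero_of_tensorContract_eq_zero rfl hθ h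
  obtain ⟨s, hs⟩ := lin.exists_leftInverse_of_injective hlin
  refine ⟨fun a => Module.Dual.eval ℂ _ (e a) ∘ₗ s, fun a b => ?_⟩
  have : s (tensorContract (LinForms n) (e.coord b) θ) = e.coord b := LinearMap.congr_fun hs _
  rw [LinearMap.comp_apply, this, Module.Dual.eval_apply, Module.Basis.coord_apply,
    e.repr_self, Finsupp.single_apply]

lemma lift_koszul {G ι : Type} [AddCommGroup G] [Module ℂ G] [Fintype ι]
    (e : Module.Basis ι ℂ G) (θ : LinForms n ⊗[ℂ] G) (j : ℕ)
    (α : ⋀[ℂ]^(j + 1) G →ₗ[ℂ] LinForms n) (w : ⋀[ℂ]^j G) :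
    TensorProduct.lift ((LinearMap.mul ℂ (CoordRing n)).compl₁₂
      (coordGrading n 1).subtype ((coordGrading n 1).subtype ∘ₗ α)) (koszul θ j w) =
    ∑ c, (tensorContract (LinForms n) (e.coord c) θ).1 * (α (wedge j (e c) w)).1 := by
  rw [koszul_eq_sum e, map_sum]
  rfl

lemma tensorCoord_lTensor_koszul {G ι : Type} [AddCommGroup G] [Module ℂ G] [Fintype ι]
    (e : Module.Basis ι ℂ G) (θ : LinForms n ⊗[ℂ] G) (i j : ℕ)
    (ψ : ⋀[ℂ]^(j + 1) G →ₗ[ℂ] F.LinSyz i) (w : ⋀[ℂ]^j G) (a : F.LinIndex i) :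
    F.tensorCoord i a (LinearMap.lTensor (LinForms n) ψ (koszul θ j w)) =
      ∑ c, ψ (wedge j (e c) w) a • tensorContract (LinForms n) (e.coord c) θ := by
  rw [koszul_eq_sum e, map_sum, map_sum]
  simp [tensorCoord]

lemma tensorCoord_ext {i : ℕ} {s t : LinForms n ⊗[ℂ] F.LinSyz i}
    (h : ∀ a, F.tensorCoord i a s = F.tensorCoord i a t) : s = t :=
  tensor_ext (Pi.basisFun ℂ (F.LinIndex i)) h

section Lift

variable {G ι : Type} [AddCommGroup G] [Module ℂ G] [Fintype ι] [DecidableEq ι]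
  (e : Module.Basis ι ℂ G) (θ : LinForms n ⊗[ℂ] G) {r : ι → Module.Dual ℂ (LinForms n)}
  (hr : ∀ a b, r a (tensorContract (LinForms n) (e.coord b) θ) = if a = b then 1 else 0)
include hr

/-- Coordinate by coordinate, `linDiff ∘ ψ₁` is a Koszul cocycle, because by `h` its differential is
`linDiff` applied twice to `ψ₂`. Exactness then provides the coordinates of `ψ₀`. -/
lemma exists_vertical_lift (i j : ℕ) (ψ₁ : ⋀[ℂ]^(j + 1) G →ₗ[ℂ] F.LinSyz (i + 1))
    (ψ₂ : ⋀[ℂ]^j G →ₗ[ℂ] F.LinSyz (i + 1 + 1))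
    (h : ∀ w, F.linDiff (i + 1) (ψ₂ w) = LinearMap.lTensor (LinForms n) ψ₁ (koszul θ j w)) :
    ∃ ψ₀ : ⋀[ℂ]^(j + 1 + 1) G →ₗ[ℂ] F.LinSyz i, ∀ w, F.linDiff i (ψ₁ w) =
      LinearMap.lTensor (LinForms n) ψ₀ (koszul θ (j + 1) w) := by
  have key : ∀ a, ∃ m' : ⋀[ℂ]^(j + 1 + 1) G →ₗ[ℂ] coordGrading n 0,
      ∀ w, (F.tensorCoord i a (F.linDiff i (ψ₁ w))).1 =
        ∑ c, (tensorContract (LinForms n) (e.coord c) θ).1 * (m' (wedge (j + 1) (e c) w)).1 := by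
    intro a
    refine exists_koszul_lift (d := 0) hr e
      ((coordGrading n 1).subtype ∘ₗ F.tensorCoord i a ∘ₗ F.linDiff i ∘ₗ ψ₁)
      (fun w => SetLike.coe_mem _) (fun w => ?_)
    have h1 := F.linDiff_linDiff i (ψ₂ w) a
    simp only [h, tensorCoord_lTensor_koszul e, AddSubmonoidClass.coe_finsetSum, Finset.sum_mul,
      Submodule.coe_smul] at h1
    rw [← h1, Finset.sum_comm]
    refine Finset.sum_congr rfl fun c _ => ?_
    simp only [LinearMap.comp_apply, Submodule.subtype_apply, tensorCoord_linDiff,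
      AddSubmonoidClass.coe_finsetSum, Submodule.coe_smul, Finset.mul_sum, mul_smul_comm,
      smul_mul_assoc]
  choose m' hm' using key
  -- The lifts take values in degree zero, so their constant coefficients recover them as scalars.
  refine ⟨LinearMap.pi fun a =>
    (MvPolynomial.lcoeff ℂ 0) ∘ₗ (coordGrading n 0).subtype ∘ₗ m' a, fun w => ?_⟩
  refine tensorCoord_ext fun a => Subtype.ext ?_
  rw [hm', tensorCoord_lTensor_koszul e, AddSubmonoidClass.coe_finsetSum]
  refine Finset.sum_congr rfl fun c _ => ?_
  have h0 : (m' a (wedge (j + 1) (e c) w)).1 ∈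
    MvPolynomial.homogeneousSubmodule (Fin (n + 1)) ℂ 0 := (m' a (wedge (j + 1) (e c) w)).2
  rw [MvPolynomial.homogeneousSubmodule_zero] at h0
  obtain ⟨z, hz⟩ := Submodule.mem_one.1 h0
  rw [← hz, Submodule.coe_smul, LinearMap.pi_apply, LinearMap.comp_apply, LinearMap.comp_apply,
    Submodule.subtype_apply, ← hz, MvPolynomial.lcoeff_apply, MvPolynomial.algebraMap_eq,
    MvPolynomial.coeff_zero_C, mul_comm, MvPolynomial.smul_eq_C_mul]

lemma exists_last_lift
    (hI : ∃ Q : Set (CoordRing n), (∀ x ∈ Q, x.IsHomogeneous 2) ∧ I = Ideal.span Q) (j : ℕ)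
    (ψ₀ : ⋀[ℂ]^(j + 1) G →ₗ[ℂ] F.LinSyz 0) (ψ₁ : ⋀[ℂ]^j G →ₗ[ℂ] F.LinSyz (0 + 1))
    (h : ∀ w, F.linDiff 0 (ψ₁ w) = LinearMap.lTensor (LinForms n) ψ₀ (koszul θ j w)) :
    ∃ α : ⋀[ℂ]^(j + 1 + 1) G →ₗ[ℂ] LinForms n, ∀ w, F.linAug (ψ₀ w) =
      ∑ c, (tensorContract (LinForms n) (e.coord c) θ).1 * (α (wedge (j + 1) (e c) w)).1 := by
  refine exists_koszul_lift (d := 1) hr e (F.linAug ∘ₗ ψ₀) (fun w => F.linAug_mem _) fun w => ?_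
  have h1 := F.linAug_linDiff hI (ψ₁ w)
  simp only [h, tensorCoord_lTensor_koszul e, AddSubmonoidClass.coe_finsetSum, Finset.sum_mul,
    Submodule.coe_smul] at h1
  rw [← h1, Finset.sum_comm]
  refine Finset.sum_congr rfl fun c _ => ?_
  simp only [LinearMap.comp_apply, linAug_apply, Finset.mul_sum, mul_smul_comm, smul_mul_assoc]

end Lift

lemma oneEquiv_wedge {G : Type} [AddCommGroup G] [Module ℂ G] (g : G) (w : ⋀[ℂ]^0 G) :
    exteriorPower.oneEquiv ℂ G (wedge 0 g w) = exteriorPower.zeroEquiv ℂ G w • g := by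
  obtain ⟨z, rfl⟩ := (exteriorPower.zeroEquiv ℂ G).symm.surjective w
  have h : (exteriorPower.zeroEquiv ℂ G).symm z = z • exteriorPower.ιMulti ℂ 0 ![] := by
    rw [LinearEquiv.symm_apply_eq, map_smul, exteriorPower.zeroEquiv_ιMulti, smul_eq_mul, mul_one]
  have h' : wedge 0 g (exteriorPower.ιMulti ℂ 0 ![]) = exteriorPower.ιMulti ℂ 1 ![g] :=
    Subtype.ext (by simp [wedge, ExteriorAlgebra.ιMulti_succ_apply])
  rw [LinearEquiv.apply_symm_apply, h, map_smul, map_smul, h', exteriorPower.oneEquiv_ιMulti]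
  rfl

lemma exists_vertical_maps (f : F.LinSyz (q + 1)) {θ : LinForms n ⊗[ℂ] involved f}
    (hθ : LinearMap.lTensor (LinForms n) (involved f).subtype θ = F.linDiff q f) (t : ℕ)
    (ht : t ≤ q) :
    ∃ ψ : ∀ i j : ℕ, i + j = q + 1 → ⋀[ℂ]^j (involved f) →ₗ[ℂ] F.LinSyz i,
      (∀ w, ψ (q + 1) 0 rfl w = exteriorPower.zeroEquiv ℂ _ w • f) ∧
      (∀ w, ψ q 1 rfl w = (exteriorPower.oneEquiv ℂ _ w).1) ∧
      ∀ (i j : ℕ) (h : i + 1 + j = q + 1) (h' : i + (j + 1) = q + 1), q ≤ i + t → ∀ w,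
        F.linDiff i (ψ (i + 1) j h w) =
          LinearMap.lTensor (LinForms n) (ψ i (j + 1) h') (koszul θ j w) := by
  let e := Module.finBasis ℂ (involved f)
  induction t with
  | zero =>
    -- At this stage only the square `i = q`, `j = 0` has to commute. All maps apart from the two
    -- prescribed ones are zero placeholders.
    let f' : ∀ i, F.LinSyz i := Function.update 0 (q + 1) f
    let g : ∀ i, involved f →ₗ[ℂ] F.LinSyz i :=
      Function.update (fun _ => 0) q (involved f).subtype
    let ψ : ∀ i j : ℕ, i + j = q + 1 → ⋀[ℂ]^j (involved f) →ₗ[ℂ] F.LinSyz i := fun i j _ =>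
      match j with
      | 0 => (exteriorPower.zeroEquiv ℂ (involved f)).toLinearMap.smulRight (f' i)
      | 1 => g i ∘ₗ (exteriorPower.oneEquiv ℂ (involved f)).toLinearMap
      | _ + 2 => 0
    have h0 : ∀ w, ψ (q + 1) 0 rfl w = exteriorPower.zeroEquiv ℂ _ w • f := by
      intro w
      simp [ψ, f']
    have h1 : ∀ w, ψ q 1 rfl w = (exteriorPower.oneEquiv ℂ _ w).1 := by
      intro w
      simp [ψ, g]
    refine ⟨ψ, h0, h1, fun i j h h' hi w => ?_⟩
    obtain rfl : i = q := by omega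
    obtain rfl : j = 0 := by omega
    have hψ : ψ i (0 + 1) h' =
        (involved f).subtype ∘ₗ (exteriorPower.oneEquiv ℂ (involved f)).toLinearMap :=
      LinearMap.ext h1
    rw [h0, map_smul, ← hθ, hψ, koszul_eq_sum e]
    conv_lhs => rw [← sum_tensorContract_tmul e θ]
    simp [oneEquiv_wedge, Finset.smul_sum]
  | succ t ih =>
    obtain ⟨ψ, h0, h1, hψ⟩ := ih (by omega)
    obtain ⟨r, hr⟩ := exists_dual_family e hθ
    obtain ⟨N, hN⟩ : ∃ N, N + (t + 1) = q := ⟨q - (t + 1), by omega⟩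
    obtain ⟨ψ₀, hψ₀⟩ := exists_vertical_lift e θ hr N t (ψ (N + 1) (t + 1) (by omega))
      (ψ (N + 1 + 1) t (by omega)) (hψ _ _ _ _ (by omega))
    -- Only the column `N = q - (t + 1)` is replaced, so the squares that already commute are
    -- untouched.
    let ψ' : ∀ i j : ℕ, i + j = q + 1 → ⋀[ℂ]^j (involved f) →ₗ[ℂ] F.LinSyz i :=
      Function.update ψ N fun j _ => (Function.update (fun _ => 0) (t + 1 + 1) ψ₀ :
        ∀ j, ⋀[ℂ]^j (involved f) →ₗ[ℂ] F.LinSyz N) j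
    have hne : ∀ i j h, i ≠ N → ψ' i j h = ψ i j h := by
      intro i j h hi
      simp only [ψ', Function.update_of_ne hi]
    refine ⟨ψ', ?_, ?_, fun i j h h' hi w => ?_⟩
    · rw [hne _ _ _ (by omega)]
      exact h0
    · rw [hne _ _ _ (by omega)]
      exact h1
    · rw [hne (i + 1) _ _ (by omega)]
      by_cases hiN : i = N
      · subst hiN
        obtain rfl : j = t + 1 := by omega
        have : ψ' i (t + 1 + 1) h' = ψ₀ := by
          simp only [ψ', Function.update_self]
        rw [this]
        exact hψ₀ w
      · rw [hne i _ _ hiN]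
        exact hψ i j h h' (by omega) w

theorem nonempty_koszulExtension
    (hI : ∃ Q : Set (CoordRing n), (∀ x ∈ Q, x.IsHomogeneous 2) ∧ I = Ideal.span Q)
    (f : F.LinSyz (q + 1)) : Nonempty (KoszulExtension f) := by
  let e := Module.finBasis ℂ (involved f)
  obtain ⟨θ, hθ⟩ := exists_lTensor_involved f
  obtain ⟨r, hr⟩ := exists_dual_family e hθ
  obtain ⟨ψ, h0, h1, hψ⟩ := exists_vertical_maps f hθ q le_rfl
  obtain ⟨α, hα⟩ := exists_last_lift e θ hr hI q (ψ 0 (q + 1) (zero_add _))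
    (ψ (0 + 1) q (by omega)) (hψ _ _ _ _ (by omega))
  exact ⟨⟨θ, hθ, ψ, α, h0, h1, fun i j h h' w => hψ i j h h' (by omega) w, fun w => by
    rw [lift_koszul e, hα]⟩⟩

namespace KoszulExtension

lemma θ_unique (E E' : KoszulExtension f) : E.θ = E'.θ :=
  lTensor_involved_injective f (E.θ_eq.trans E'.θ_eq.symm)

/-- The vertical maps, except the last one, are determined by the syzygy. -/
lemma ψ_unique (E E' : KoszulExtension f) (i j : ℕ) (h : i + j = q + 1) :
    E.ψ i j h = E'.ψ i j h := by
  let e := Module.finBasis ℂ (involved f)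
  obtain ⟨r, hr⟩ := exists_dual_family e E.θ_eq
  induction j generalizing i with
  | zero =>
    obtain rfl : i = q + 1 := h
    exact LinearMap.ext fun w => (E.ψ_zero w).trans (E'.ψ_zero w).symm
  | succ j ih =>
    refine exteriorPower_linearMap_ext e fun c w => funext fun a => ?_
    have h1 := E.comm i j (by omega) h w
    rw [ih, E'.comm i j (by omega) h w] at h1
    -- Both sides are combinations of the independent forms `L_c` with coefficients `ψ(e_c ∧ w)`;
    -- the dual functional `r c` isolates one of them.
    have h2 := congrArg (fun t => r c (F.tensorCoord i a t)) h1
    simp only [tensorCoord_lTensor_koszul e, ← θ_unique E E', map_sum, map_smul, hr] at h2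
    simpa using h2.symm

lemma syzygyIdeal_unique (E E' : KoszulExtension f) : E.syzygyIdeal = E'.syzygyIdeal := by
  apply HomogeneousIdeal.toIdeal_injective
  change Ideal.span (Set.range E.quadric) = Ideal.span (Set.range E'.quadric)
  -- The quadrics involve only `ψ 0`, so no uniqueness of `α` is required.
  rw [quadric, quadric, ψ_unique E E']

lemma quadric_apply {ι : Type} [Fintype ι] (E : KoszulExtension f)
    (e : Module.Basis ι ℂ (involved f)) (w : ⋀[ℂ]^(q + 1) (involved f)) :
    E.quadric w = ∑ c, (E.linearForms (e.coord c)).1 * (E.α (wedge (q + 1) (e c) w)).1 :=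
  (E.comm_aug w).trans (lift_koszul e E.θ (q + 1) E.α w)

end KoszulExtension

end Extension

/-! ### The generic quadrics in a basis. -/

section Generic

variable {G : Type} [AddCommGroup G] [Module ℂ G]

lemma comult_eq_sum {ι : Type} [Fintype ι] (e : Module.Basis ι ℂ G) (k : ℕ)
    (η : ⋀[ℂ]^(k + 1) (Module.Dual ℂ G)) :
    comult G k η = ∑ a, e.coord a ⊗ₜ[ℂ] interior k (Module.Dual.eval ℂ G (e a)) η := by
  let R : ⋀[ℂ]^(k + 1) (Module.Dual ℂ G) →ₗ[ℂ]
      Module.Dual ℂ G ⊗[ℂ] ⋀[ℂ]^k (Module.Dual ℂ G) :=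
    ∑ a, TensorProduct.mk ℂ _ _ (e.coord a) ∘ₗ interior k (Module.Dual.eval ℂ G (e a))
  have : comult G k = R := by
    apply exteriorPower.linearMap_ext
    ext ξ
    have h1 : ∀ a, interior k (Module.Dual.eval ℂ G (e a))
        (exteriorPower.ιMulti ℂ (k + 1) ξ) = ∑ i : Fin (k + 1), (-1 : ℤ) ^ (i : ℕ) •
          (ξ i (e a) • exteriorPower.ιMulti ℂ k fun j => ξ (i.succAbove j)) := by
      intro a
      apply Subtype.ext
      rw [AddSubmonoidClass.coe_finsetSum]
      exact contractLeft_ιMulti (Module.Dual.eval ℂ G (e a)) k ξ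
    rw [LinearMap.compAlternatingMap_apply, LinearMap.compAlternatingMap_apply, comult_ιMulti,
      LinearMap.sum_apply]
    simp only [LinearMap.comp_apply, h1, TensorProduct.mk_apply, TensorProduct.tmul_sum]
    rw [Finset.sum_comm]
    refine Finset.sum_congr rfl fun i _ => ?_
    simp only [TensorProduct.tmul_smul]
    rw [← Finset.smul_sum]
    congr 1
    -- What remains is the expansion `ξ_i = ∑ ξ_i(e_a) e_a*`.
    simp only [TensorProduct.smul_tmul', ← TensorProduct.sum_tmul]
    congr 1
    refine e.ext fun b => ?_
    classical
    simp
  rw [this, LinearMap.sum_apply]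
  rfl

lemma genericQuadric_eq_sum {ι : Type} [Fintype ι] (e : Module.Basis ι ℂ G) (k : ℕ)
    (η : ⋀[ℂ]^(k + 1) (Module.Dual ℂ G)) :
    genericQuadric G k η = ∑ a, SymmetricAlgebra.ι ℂ (GenericForms G k) (e.coord a, 0) *
      SymmetricAlgebra.ι ℂ (GenericForms G k)
        (0, interior k (Module.Dual.eval ℂ G (e a)) η) := by
  rw [genericQuadric, LinearMap.comp_apply, comult_eq_sum e, map_sum]
  rfl

lemma lift_genericQuadric {n : ℕ} {ι : Type} [Fintype ι] (e : Module.Basis ι ℂ G) {k : ℕ}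
    (φ : GenericForms G k →ₗ[ℂ] LinForms n) (η : ⋀[ℂ]^(k + 1) (Module.Dual ℂ G)) :
    SymmetricAlgebra.lift ((coordGrading n 1).subtype ∘ₗ φ) (genericQuadric G k η) =
      ∑ a, (φ (e.coord a, 0)).1 * (φ (0, interior k (Module.Dual.eval ℂ G (e a)) η)).1 := by
  rw [genericQuadric_eq_sum e, map_sum]
  refine Finset.sum_congr rfl fun a _ => ?_
  rw [map_mul, SymmetricAlgebra.lift_ι_apply, SymmetricAlgebra.lift_ι_apply]
  rfl

end Generic

/-! ### Comparison of the generic quadrics with those of the syzygy; cones over linear sections. -/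

namespace KoszulExtension

open MinimalFreeResolution

variable {n : ℕ} {I : Ideal (CoordRing n)} {F : MinimalFreeResolution I} {q k : ℕ}
  {f : F.LinSyz (q + 1)} (E : KoszulExtension f)
  (ω : ⋀[ℂ]^(q + 1 + 1 + k) (involved f))

/-- The generic quadrics restrict to the quadrics of the syzygy ideal. -/
lemma lift_genericQuadric_eq_quadric (hf : syzRank f = q + 1 + 1 + k)
    (η : ⋀[ℂ]^(k + 1) (Module.Dual ℂ (involved f))) (w : ⋀[ℂ]^(q + 1) (involved f))
    (hw : contract (involved f) η.1 ω.1 = w.1) :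
    SymmetricAlgebra.lift ((coordGrading n 1).subtype ∘ₗ E.φ ω)
        (genericQuadric (involved f) k η) = E.quadric w := by
  let e := Module.finBasis ℂ (involved f)
  rw [lift_genericQuadric e, E.quadric_apply e]
  refine Finset.sum_congr rfl fun a _ => ?_
  have h1 : E.φ ω (e.coord a, 0) = E.linearForms (e.coord a) := by
    rw [φ, LinearMap.coprod_apply, map_zero, add_zero]
  have h2 : E.φ ω (0, interior k (Module.Dual.eval ℂ _ (e a)) η) =
      E.α (contractWith ω (interior k (Module.Dual.eval ℂ _ (e a)) η)) := by
    rw [φ, LinearMap.coprod_apply, map_zero, zero_add, LinearMap.comp_apply]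
  rw [h1, h2]
  congr 3
  apply Subtype.ext
  change contract (involved f) (CliffordAlgebra.contractLeft
    (Q := (0 : QuadraticForm ℂ (Module.Dual ℂ (involved f)))) _ η.1) ω.1 =
      ExteriorAlgebra.ι ℂ (e a) * w.1
  -- The rank hypothesis puts `ω` in top degree, so `e_a ∧ ω = 0`.
  rw [← hw, ι_mul_contract (ι_mul_eq_zero_of_finrank _ hf _ ω.2)]

/-- The map `η ↦ η ⌟ ω` takes `⋀^(k+1) G*` onto `⋀^(q+1) G` and matches the two families of
quadrics. -/
lemma map_range_genericQuadric (hf : syzRank f = q + 1 + 1 + k) (hω : ω ≠ 0) :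
    (LinearMap.range (genericQuadric (involved f) k)).map
        (SymmetricAlgebra.lift ((coordGrading n 1).subtype ∘ₗ E.φ ω)).toLinearMap =
      LinearMap.range E.quadric := by
  apply le_antisymm
  · rintro _ ⟨_, ⟨η, rfl⟩, rfl⟩
    have hm := contract_mem (m := q + 1) η.2 (x := ω.1) (by
      rw [show q + 1 + (k + 1) = q + 1 + 1 + k by omega]; exact ω.2)
    exact ⟨⟨_, hm⟩, (E.lift_genericQuadric_eq_quadric ω hf η ⟨_, hm⟩ rfl).symm⟩
  · rintro _ ⟨w, rfl⟩
    obtain ⟨η, hη, h⟩ := exists_contract_eq hf ω.2 (fun h => hω (Subtype.ext h))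
      (j := q + 1) (k := k + 1) (by omega) w.2
    exact ⟨_, ⟨⟨η, hη⟩, rfl⟩, E.lift_genericQuadric_eq_quadric ω hf ⟨η, hη⟩ w h⟩

lemma map_genericSyzygyIdeal (hf : syzRank f = q + 1 + 1 + k) (hω : ω ≠ 0) :
    (genericSyzygyIdeal (involved f) k).map (symLift (coordGrading n) (E.φ ω)) =
      E.syzygyIdeal := by
  apply HomogeneousIdeal.toIdeal_injective
  have h := congrArg (fun M : Submodule ℂ (CoordRing n) => (M : Set (CoordRing n)))
    (E.map_range_genericQuadric ω hf hω)
  simp only [Submodule.map_coe, LinearMap.coe_range] at h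
  change Ideal.map (SymmetricAlgebra.lift
    ((coordGrading n 1).subtype ∘ₗ E.φ ω)).toRingHom (Ideal.span _) = Ideal.span _
  rw [Ideal.map_span, ← h]
  rfl

end KoszulExtension

/-- The equations of a cone over a linear section are the images of the original equations. -/
lemma cone_linearSection {n : ℕ} {U : Type} [AddCommGroup U] [Module ℂ U]
    (φ : U →ₗ[ℂ] LinForms n) (J : HomogeneousIdeal (symGrading U)) :
    cone (LinearMap.range φ) (linearSection φ.rangeRestrict J) =
      J.map (symLift (coordGrading n) φ) := by
  apply HomogeneousIdeal.toIdeal_injective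
  change Ideal.map (SymmetricAlgebra.lift _).toRingHom
    (Ideal.map (SymmetricAlgebra.lift _).toRingHom _) =
      Ideal.map (SymmetricAlgebra.lift _).toRingHom _
  rw [Ideal.map_map]
  congr 1
  let Φ := SymmetricAlgebra.lift ((coordGrading n 1).subtype ∘ₗ (LinearMap.range φ).subtype)
  let Ψ := SymmetricAlgebra.lift ((symGrading (LinearMap.range φ) 1).subtype ∘ₗ
    symDegreeOne (LinearMap.range φ) ∘ₗ φ.rangeRestrict)
  -- Both algebra maps agree on generators, as `φ` is its range restriction followed by the
  -- inclusion.
  have : Φ.comp Ψ = SymmetricAlgebra.lift ((coordGrading n 1).subtype ∘ₗ φ) := by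
    apply SymmetricAlgebra.algHom_ext
    ext1 u
    simp [Φ, Ψ, symDegreeOne]
  exact congrArg AlgHom.toRingHom this

end GenSyz

end

theorem theorem3p4 {n : ℕ} (I : Ideal (GenSyz.CoordRing n))
    (hI : ∃ Q : Set (GenSyz.CoordRing n), (∀ x ∈ Q, x.IsHomogeneous 2) ∧ I = Ideal.span Q)
    (F : GenSyz.MinimalFreeResolution I)
    (q k : ℕ) (f : F.LinSyz (q + 1))
    (hf : GenSyz.MinimalFreeResolution.syzRank f = (q + 1) + k + 1) :
    Nonempty (GenSyz.KoszulExtension f) ∧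
    (∀ E E' : GenSyz.KoszulExtension f, E.syzygyIdeal = E'.syzygyIdeal) ∧
    ∀ (E : GenSyz.KoszulExtension f)
      (ω : ⋀[ℂ]^(q + 1 + 1 + k) (GenSyz.MinimalFreeResolution.involved f)), ω ≠ 0 →
      (LinearMap.range (GenSyz.genericQuadric (GenSyz.MinimalFreeResolution.involved f) k)).map
          (SymmetricAlgebra.lift
            ((GenSyz.coordGrading n 1).subtype ∘ₗ E.φ ω)).toLinearMap =
        LinearMap.range E.quadric ∧
      (GenSyz.genericSyzygyIdeal (GenSyz.MinimalFreeResolution.involved f) k).map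
          (GenSyz.symLift (GenSyz.coordGrading n) (E.φ ω)) = E.syzygyIdeal ∧
      E.syzygyIdeal = GenSyz.cone (LinearMap.range (E.φ ω))
          (GenSyz.linearSection (E.φ ω).rangeRestrict
            (GenSyz.genericSyzygyIdeal (GenSyz.MinimalFreeResolution.involved f) k)) ∧
      Nonempty (E.Syz ≅ GenSyz.closedSubscheme (GenSyz.cone (LinearMap.range (E.φ ω))
          (GenSyz.linearSection (E.φ ω).rangeRestrict
            (GenSyz.genericSyzygyIdeal (GenSyz.MinimalFreeResolution.involved f) k)))) := by
  have hf' : GenSyz.MinimalFreeResolution.syzRank f = q + 1 + 1 + k := by omega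
  refine ⟨GenSyz.nonempty_koszulExtension hI f, GenSyz.KoszulExtension.syzygyIdeal_unique,
    fun E ω hω => ?_⟩
  have h := E.map_genericSyzygyIdeal ω hf' hω
  have hc : E.syzygyIdeal = GenSyz.cone (LinearMap.range (E.φ ω))
      (GenSyz.linearSection (E.φ ω).rangeRestrict
        (GenSyz.genericSyzygyIdeal (GenSyz.MinimalFreeResolution.involved f) k)) := by
    rw [GenSyz.cone_linearSection, h]
  refine ⟨E.map_range_genericQuadric ω hf' hω, h, hc, ?_⟩
  -- Equal ideals define the same closed subscheme, so the identity is the required isomorphism.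
  rw [← hc]
  exact ⟨CategoryTheory.Iso.refl _⟩
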